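/- Let $n\in\mathbb N$, $f^0\in\mathbb R^n$, $\sigma>0$, and observe $Y=f^0+\epsilon$ with $\epsilon\sim\mathcal N_n(0,\sigma^2 I_n)$. Write $\|v\|_n^2=\frac1n\sum_{i=1}^n v_i^2$ for $v\in\mathbb R^n$. Let $D\in\mathbb R^{n\times n}$ be the incidence matrix of the directed cycle graph with vertices $1,\dots,n$ and edges $(1,2),\dots,(n-1,n),(n,1)$, i.e. $(Df)_j=f_{j+1}-f_j$ with indices modulo $n$. For $\lambda_0>0$ let $\hat f$ be a square root analysis estimator, that is, a (measurable) random vector that minimizes $g\mapsto\|Y-g\|_n+\lambda_0\|Dg\|_1$ over $\mathbb R^n$ almost surely. Let $S\subseteq\{1,\dots,n\}$ be a non-empty set of edges that is admissible, i.e. $S=\{j:(Df)_j\neq0\}$ for some $f\in\mathbb R^n$. Let $D_{-S}$ be the matrix of the rows of $D$ with index not in $S$, let $(Df)_{-S}$ be the restriction of $Df$ to the indices not in $S$, and let $r_S$ be the dimension of the null space of $D_{-S}$. Let $n_1,\dots,n_{r_S}$ be the numbers of vertices of the connected components of the cycle graph with the edges in $S$ removed, let $n_{\max}=\max_i n_i$,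 and put $$K'=\sum_{i=1}^{r_S}\left(\frac1{\lfloor n_i/2\rfloor}+\frac1{\lceil n_i/2\rceil}\right).$$ Suppose that $n_i\ge4$ for all $i$. Let $a>0$ with $n>8a$ and $\eta\in(0,1)$. Suppose that $$\eta>2\,\frac{\sqrt{r_S}+\sqrt{2a}}{\sqrt{n-\sqrt{8an}}},\qquad \|Df^0\|_1\le\frac{c\,\sigma\sqrt{1-\sqrt{8a/n}}}{\lambda_0},\qquad c=\sqrt{\left(\frac\eta2-\frac{\sqrt{r_S}+\sqrt{2a}}{\sqrt{n-\sqrt{8an}}}\right)^2+4}-2,$$ that $\lambda_0\ge R/(1-\eta)$ for some $R>0$, that $0<t<\frac{n-1}2-\log(2(n-r_S))$, and that $$\lambda_0\ge\frac1{1-\eta}\sqrt{n_{\max}\frac{\log(2n)+t}{n(n-1)}}.$$ Then, for every $f\in\mathbb R^n$, with probability at least $1-e^{-t}-4e^{-a}$, $$\|\hat f-f^0\|_n^2\le\|f-f^0\|_n^2+16\lambda_0\sigma\|(Df)_{-S}\|_1+\sigma^2\left(\sqrt{\frac{2a}n}+\sqrt{\frac{r_S}n}+4\lambda_0\sqrt{nK'}+\frac{4\sqrt{10}}{1-\eta}\sqrt{\frac{r_S}{n-1}\,(\log(2n)+t)\,\log\frac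 n{r_S}}\right)^2.$$ (When the last condition on $\lambda_0$ holds with equality, $4\lambda_0\sqrt{nK'}=\frac4{1-\eta}\sqrt{\frac{n_{\max}K'}{n-1}(\log(2n)+t)}$.) -/

import Mathlib

open MeasureTheory ProbabilityTheory

namespace SqrtTV

/-! ### Norms -/

/-- The normalized Euclidean norm: the square root of `∑ i, f i ^ 2 / n`. -/
noncomputable def normN {n : ℕ} (f : Fin n → ℝ) : ℝ :=
  √((∑ i, f i ^ 2) / n)

/-- The `ℓ¹` norm `∑ j, |v j|`. -/
def normL1 {ι : Type*} [Fintype ι] (v : ι → ℝ) : ℝ :=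
  ∑ j, |v j|

/-! ### Analysis operators, active sets and the square root analysis estimator -/

section Analysis

variable {ι : Type*} {n : ℕ}

/-- The matrix formed by the rows of `D` whose index is not in `S`. -/
def rowsOff (D : Matrix ι (Fin n) ℝ) (S : Finset ι) : Matrix {j : ι // j ∉ S} (Fin n) ℝ :=
  D.submatrix Subtype.val id

/-- `S` is an admissible active set: it is the support of `D f` for some signal `f`. -/
def Admissible (D : Matrix ι (Fin n) ℝ) (S : Finset ι) : Prop :=
  ∃ f : Fin n → ℝ, ∀ j, j ∈ S ↔ D.mulVec f j ≠ 0

/-- `r_S`, the dimension of the null space of the matrix of the rows of `D` outside `S`. -/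
noncomputable def rDim (D : Matrix ι (Fin n) ℝ) (S : Finset ι) : ℕ :=
  Module.finrank ℝ (LinearMap.ker (rowsOff D S).mulVecLin)

variable [Fintype ι]

/-- The objective function of the square root analysis estimator for the data `y`. -/
noncomputable def sqrtObjective (D : Matrix ι (Fin n) ℝ) (lam : ℝ) (y f : Fin n → ℝ) : ℝ :=
  normN (y - f) + lam * normL1 (D.mulVec f)

/-- `fhat` minimizes the square root analysis objective for the data `y`. -/
def IsSqrtAnalysisEstimator (D : Matrix ι (Fin n) ℝ) (lam : ℝ) (y fhat : Fin n → ℝ) : Prop :=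
  ∀ f : Fin n → ℝ, sqrtObjective D lam y fhat ≤ sqrtObjective D lam y f

/-- The ratio `(√r + √(2a)) / √(n - √(8an))`. -/
noncomputable def noiseRatio (n r : ℕ) (a : ℝ) : ℝ :=
  (√(r : ℝ) + √(2 * a)) / √((n : ℝ) - √(8 * a * n))

/-- The constant `c = √((η/2 - (√r + √(2a)) / √(n - √(8an)))² + 4) - 2`. -/
noncomputable def signalConst (n r : ℕ) (a η : ℝ) : ℝ :=
  √((η / 2 - noiseRatio n r a) ^ 2 + 4) - 2

/-- The standing assumption on the tuning parameter `lam`, the true signal `f0`, the noise level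
`σ`, the constants `a`, `η`, and the active set `S`. -/
structure SqrtAssumption (D : Matrix ι (Fin n) ℝ) (S : Finset ι) (f0 : Fin n → ℝ)
    (σ a η lam : ℝ) : Prop where
  a_pos : 0 < a
  a_lt : 8 * a < n
  η_pos : 0 < η
  η_lt : η < 1
  tuning : ∃ R : ℝ, 0 < R ∧ 1 / (1 - η) * R ≤ lam
  signal : normL1 (D.mulVec f0) ≤
    signalConst n (rDim D S) a η * σ * √(1 - √(8 * a / n)) / lam
  admissible : Admissible D S
  active : 2 * noiseRatio n (rDim D S) a < η

end Analysis

/-! ### Incidence matrices and the cycle graph -/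

section Graph

variable {V E : Type*}

/-- The incidence matrix of the directed graph whose edge `e` goes from `tail e` to `head e`. -/
def incidence [DecidableEq V] (tail head : E → V) : Matrix E V ℝ :=
  Matrix.of fun e v => if v = tail e then -1 else if v = head e then 1 else 0

/-- The undirected graph that remains when the edges with index in `S` are removed. -/
def removeEdges (tail head : E → V) (S : Finset E) : SimpleGraph V :=
  SimpleGraph.fromRel fun u v => ∃ e, e ∉ S ∧ tail e = u ∧ head e = v

end Graph

/-- The incidence matrix of the directed cycle on `n` vertices, whose edge `i` goes from the
vertex `i` to its cyclic successor. -/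
def cycleD (n : ℕ) : Matrix (Fin n) (Fin n) ℝ :=
  incidence (fun i => i) (fun i => finRotate n i)

/-- The cycle on `n` vertices with the edges in `S` removed. -/
def cycleMinus {n : ℕ} (S : Finset (Fin n)) : SimpleGraph (Fin n) :=
  removeEdges (fun i => i) (fun i => finRotate n i) S

/-- The number of vertices of a connected component of the cycle without the edges in `S`. -/
noncomputable def compSize {n : ℕ} (S : Finset (Fin n))
    (C : (cycleMinus S).ConnectedComponent) : ℕ :=
  C.supp.ncard

/-- The smallest number of vertices of a connected component. -/
noncomputable def nMin {n : ℕ} (S : Finset (Fin n)) : ℕ :=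
  ⨅ C : (cycleMinus S).ConnectedComponent, compSize S C

/-- The largest number of vertices of a connected component. -/
noncomputable def nMax {n : ℕ} (S : Finset (Fin n)) : ℕ :=
  ⨆ C : (cycleMinus S).ConnectedComponent, compSize S C

/-- `K'`, the sum over the connected components, with `N` the number of vertices, of
`1 / ⌊N/2⌋ + 1 / ⌈N/2⌉`. -/
noncomputable def kPrime {n : ℕ} (S : Finset (Fin n)) : ℝ :=
  ∑ᶠ C : (cycleMinus S).ConnectedComponent,
    (1 / ((compSize S C / 2 : ℕ) : ℝ) + 1 / (((compSize S C + 1) / 2 : ℕ) : ℝ))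

end SqrtTV

/-! Removing the edges in `S` cuts the cycle into arcs, one for each edge of `S`. Relative to these
arcs the noise splits in two. Its projection on the arcwise constant functions, a space of dimension
`r_S`, has norm at most `σ (√r_S + √(2a))` with high probability. By summation by parts, the rest
pairs with a vector `h` through the increments of `h` off `S`, weighted by inner products of the
noise with centered steps (`dotProduct_eq_arcMean_add_arcStep`). Divided by the norms of the noise
and of the step, these are self-normalized Gaussians, so one union bound controls them all without
knowledge of `σ` (`selfNormalized_tail`, `goodNoise_compl_le`).

On this event the argument is deterministic. First, the estimator does not overfit: its error is at
most `η ‖ε‖` (`norm_minimizer_sub_le`), so the residual is at least `(1 - η) ‖ε‖` and the penalty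
level, which is `λ₀` times the residual norm up to scaling, dominates the noise. Second, the first
order condition of the square root loss gives a Lasso-type inequality at that penalty level
(`norm_minimizer_sub_sq_le`). Third, the penalty difference is compared with the Euclidean norm
through a dual certificate that interpolates the signs on `S` (`compatibility_arc`): its linear
slopes give `K'`, and its noise weights give the logarithmic term.

The constants 4 and 16 come from `‖ε‖ ≤ 3σ√n` and a residual of at most `(4/3) ‖ε‖`. -/

namespace SqrtTV

/-! ### Gaussian concentration: chi-square and self-normalized tails -/

section Gaussian

variable {ι : Type*} [Fintype ι]

/-- The law of a standard Gaussian vector with independent coordinates. -/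
noncomputable abbrev stdPi (ι : Type*) [Fintype ι] : Measure (ι → ℝ) :=
  Measure.pi fun _ => gaussianReal 0 1

lemma integral_exp_mul_sq_gaussianReal {c : ℝ} (hc : c < 1 / 2) :
    ∫ x, Real.exp (c * x ^ 2) ∂(gaussianReal 0 1) = (√(1 - 2 * c))⁻¹ := by
  rw [integral_gaussianReal_eq_integral_smul one_ne_zero]
  have h1 : ∀ x : ℝ, gaussianPDFReal 0 1 x • Real.exp (c * x ^ 2)
      = (√(2 * Real.pi))⁻¹ * Real.exp (-(1 / 2 - c) * x ^ 2) := by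
    intro x
    simp only [gaussianPDFReal, NNReal.coe_one, mul_one, sub_zero, smul_eq_mul, mul_assoc,
      ← Real.exp_add]
    congr 2
    ring
  simp_rw [h1]
  rw [integral_const_mul, integral_gaussian, ← Real.sqrt_inv, ← Real.sqrt_mul (by positivity),
    ← Real.sqrt_inv]
  congr 1
  have : 1 / 2 - c ≠ 0 := by linarith
  have : 1 - 2 * c ≠ 0 := by linarith
  field_simp

lemma integral_exp_mul_sum_sq (s : Finset ι) {c : ℝ} (hc : c < 1 / 2) :
    ∫ x, Real.exp (c * ∑ i ∈ s, x i ^ 2) ∂(stdPi ι) = (√(1 - 2 * c))⁻¹ ^ s.card := by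
  classical
  have h1 : ∀ x : ι → ℝ, Real.exp (c * ∑ i ∈ s, x i ^ 2)
      = ∏ i, (fun y : ℝ => if i ∈ s then Real.exp (c * y ^ 2) else 1) (x i) := by
    intro x
    rw [Finset.mul_sum, Real.exp_sum]
    simp
  simp_rw [h1]
  rw [integral_fintype_prod_eq_prod (fun i (y : ℝ) => if i ∈ s then Real.exp (c * y ^ 2) else 1)]
  have h2 : ∀ i, (∫ y, (if i ∈ s then Real.exp (c * y ^ 2) else 1) ∂(gaussianReal 0 1))
      = if i ∈ s then (√(1 - 2 * c))⁻¹ else 1 := by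
    intro i
    split_ifs
    · exact integral_exp_mul_sq_gaussianReal hc
    · simp
  simp_rw [h2]
  simp

lemma integrable_exp_mul_sum_sq (s : Finset ι) {c : ℝ} (hc : c < 1 / 2) :
    Integrable (fun x : ι → ℝ => Real.exp (c * ∑ i ∈ s, x i ^ 2)) (stdPi ι) := by
  -- A non-integrable function has integral 0 by convention, whereas the product formula gives a
  -- positive value.
  by_contra h
  have h1 := integral_exp_mul_sum_sq s hc
  rw [integral_undef h] at h1
  have : 0 < √(1 - 2 * c) := Real.sqrt_pos.2 (by linarith)
  have : 0 < (√(1 - 2 * c))⁻¹ ^ s.card := by positivity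
  linarith

lemma chiSq_upper_chernoff (s : Finset ι) {c : ℝ} (hc0 : 0 ≤ c) (hc : c < 1 / 2) (z : ℝ) :
    (stdPi ι).real {x | z ≤ ∑ i ∈ s, x i ^ 2} ≤
      Real.exp (-c * z) * (√(1 - 2 * c))⁻¹ ^ s.card := by
  rw [← integral_exp_mul_sum_sq s hc]
  exact measure_ge_le_exp_mul_mgf z hc0 (integrable_exp_mul_sum_sq s hc)

lemma chiSq_lower_chernoff (s : Finset ι) {c : ℝ} (hc0 : c ≤ 0) (z : ℝ) :
    (stdPi ι).real {x | ∑ i ∈ s, x i ^ 2 ≤ z} ≤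
      Real.exp (-c * z) * (√(1 - 2 * c))⁻¹ ^ s.card := by
  have hc : c < 1 / 2 := by linarith
  rw [← integral_exp_mul_sum_sq s hc]
  exact measure_le_le_exp_mul_mgf z hc0 (integrable_exp_mul_sum_sq s hc)

lemma inv_sqrt_pow_eq_exp {y : ℝ} (hy : 0 < y) (k : ℕ) :
    (√y)⁻¹ ^ k = Real.exp (-(k / 2 * Real.log y)) := by
  have h : (√y)⁻¹ = Real.exp (-(1 / 2 * Real.log y)) := by
    rw [Real.exp_neg, Real.sqrt_eq_rpow, Real.rpow_def_of_pos hy]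
    congr 2
    ring
  rw [h, ← Real.exp_nat_mul]
  congr 1
  ring

lemma chiSq_upper_tail {s : Finset ι} (hs : s.Nonempty) {a : ℝ} (ha : 0 < a) :
    (stdPi ι).real {x | (√(s.card : ℝ) + √(2 * a)) ^ 2 ≤ ∑ i ∈ s, x i ^ 2} ≤ Real.exp (-a) := by
  have hr : (0 : ℝ) < s.card := by exact_mod_cast hs.card_pos
  set r : ℝ := (s.card : ℝ) with hr_def
  set u : ℝ := √(2 * a) / √r with hu_def
  have hsr : 0 < √r := Real.sqrt_pos.2 hr
  have hsa : 0 < √(2 * a) := Real.sqrt_pos.2 (by linarith)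
  have hu : 0 < u := by positivity
  have hua : r * u ^ 2 = 2 * a := by
    rw [hu_def, div_pow, Real.sq_sqrt hr.le, Real.sq_sqrt (by linarith)]
    field_simp
  have hz : (√r + √(2 * a)) ^ 2 = r * (1 + u) ^ 2 := by
    have : √(2 * a) = √r * u := by rw [hu_def]; field_simp
    rw [this, show √r + √r * u = √r * (1 + u) by ring, mul_pow, Real.sq_sqrt hr.le]
  -- This is the optimal Chernoff parameter for the threshold `r (1 + u)²`. The exponent is
  -- `-(r/2)(2u + u²) + r log (1 + u)`, at most `-r u²/2 = -a`.
  set c : ℝ := (1 - ((1 + u) ^ 2)⁻¹) / 2 with hc_def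
  have hinv : ((1 + u) ^ 2)⁻¹ ≤ 1 := inv_le_one_of_one_le₀ (by nlinarith)
  have hinv0 : 0 < ((1 + u) ^ 2)⁻¹ := by positivity
  have hc1 : 1 - 2 * c = ((1 + u) ^ 2)⁻¹ := by rw [hc_def]; ring
  refine (chiSq_upper_chernoff s (c := c) (by linarith) (by linarith) _).trans ?_
  rw [inv_sqrt_pow_eq_exp (by rw [hc1]; exact hinv0), ← Real.exp_add, Real.exp_le_exp, hc1, hz,
    Real.log_inv, Real.log_pow, ← hr_def]
  have hl : Real.log (1 + u) ≤ u := by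
    have := Real.log_le_sub_one_of_pos (show 0 < 1 + u by linarith)
    linarith
  have hcz : -c * (r * (1 + u) ^ 2) = -(r / 2) * (2 * u + u ^ 2) := by
    rw [hc_def]; field_simp; ring
  rw [hcz]
  push_cast
  nlinarith [mul_le_mul_of_nonneg_left hl hr.le]

lemma chiSq_lower_tail [Nonempty ι] {a : ℝ} (ha : 0 < a) :
    (stdPi ι).real {x | ∑ i, x i ^ 2 ≤ (Fintype.card ι : ℝ) - √(8 * a * Fintype.card ι)} ≤
      Real.exp (-a) := by
  have hn : (0 : ℝ) < Fintype.card ι := by exact_mod_cast Fintype.card_pos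
  set n : ℝ := (Fintype.card ι : ℝ) with hn_def
  set y : ℝ := √(8 * a * n) with hy_def
  have hy2 : y ^ 2 = 8 * a * n := Real.sq_sqrt (by positivity)
  have hy : 0 ≤ y := Real.sqrt_nonneg _
  -- This minimizes `-t y + n t²`, the exponent left after `log (1 + 2t) ≥ 2t - 2t²`. The minimum is
  -- `-2a`, so there is room to spare.
  set t : ℝ := y / (2 * n) with ht_def
  have ht : 0 ≤ t := by positivity
  have htn : 2 * n * t = y := by rw [ht_def]; field_simp
  refine (chiSq_lower_chernoff Finset.univ (c := -t) (by linarith) _).trans ?_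
  rw [inv_sqrt_pow_eq_exp (by linarith), ← Real.exp_add, Real.exp_le_exp, Finset.card_univ,
    ← hn_def]
  have hl : 2 * t - 2 * t ^ 2 ≤ Real.log (1 - 2 * -t) := by
    have h1 := Real.le_log_one_add_of_nonneg (show 0 ≤ 2 * t by linarith)
    rw [show 1 - 2 * -t = 1 + 2 * t by ring]
    refine le_trans ?_ h1
    rw [le_div_iff₀ (by linarith)]
    nlinarith [pow_nonneg ht 3]
  have h2 : n * t ^ 2 = 2 * a := by
    have : n * (n * t ^ 2) = n * (2 * a) := by nlinarith
    exact mul_left_cancel₀ hn.ne' this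
  have h3 := mul_le_mul_of_nonneg_left hl hn.le
  have h4 : t * y = 4 * a := by rw [← htn]; nlinarith
  nlinarith

/-- A crude bound `‖z‖ ≤ 3√n`, needed only to bound the residual from above; its failure probability
is absorbed into `exp (-a)`. -/
lemma chiSq_large [Nonempty ι] :
    (stdPi ι).real {x | 9 * (Fintype.card ι : ℝ) ≤ ∑ i, x i ^ 2} ≤
      Real.exp (-(Fintype.card ι : ℝ)) := by
  have hn : (0 : ℝ) < Fintype.card ι := by exact_mod_cast Fintype.card_pos
  refine (chiSq_upper_chernoff Finset.univ (c := 1 / 4) (by norm_num) (by norm_num) _).trans ?_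
  rw [inv_sqrt_pow_eq_exp (by norm_num), ← Real.exp_add, Real.exp_le_exp, Finset.card_univ]
  have : -1 ≤ Real.log (1 - 2 * (1 / 4)) := by
    rw [Real.le_log_iff_exp_le (by norm_num), Real.exp_neg]
    rw [inv_le_comm₀ (Real.exp_pos _) (by norm_num)]
    have := Real.add_one_le_exp (1 : ℝ)
    norm_num at this ⊢
    linarith
  nlinarith

lemma gaussianReal_tail (y : ℝ) (hy : 0 ≤ y) :
    (gaussianReal 0 1).real {x | y ^ 2 < x ^ 2} ≤ 2 * Real.exp (-(y ^ 2 / 2)) := by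
  have h1 : (gaussianReal 0 1).real {x | y ≤ x} ≤ Real.exp (-(y ^ 2 / 2)) := by
    refine (measure_ge_le_exp_mul_mgf (X := fun x => x) y hy
      (integrable_exp_mul_gaussianReal y)).trans ?_
    rw [mgf_fun_id_gaussianReal, ← Real.exp_add]
    apply le_of_eq
    congr 1
    push_cast
    ring
  have h2 : (gaussianReal 0 1).real {x | x ≤ -y} ≤ Real.exp (-(y ^ 2 / 2)) := by
    refine (measure_le_le_exp_mul_mgf (X := fun x => x) (t := -y) (-y) (by linarith)
      (integrable_exp_mul_gaussianReal (-y))).trans ?_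
    rw [mgf_fun_id_gaussianReal, ← Real.exp_add]
    apply le_of_eq
    congr 1
    push_cast
    ring
  have h3 : {x : ℝ | y ^ 2 < x ^ 2} ⊆ {x | y ≤ x} ∪ {x | x ≤ -y} := by
    intro x hx
    simp only [Set.mem_ofPred_eq, Set.mem_union] at hx ⊢
    by_contra! h
    nlinarith
  calc _ ≤ _ := measureReal_mono h3
    _ ≤ _ := measureReal_union_le _ _
    _ ≤ _ := by linarith

/-- For `s² < 1` the event says that `x i ^ 2` exceeds `κ = s²/(1 - s²)` times the sum of the other
squares. Given the other coordinates this has a Gaussian tail, and integrating that tail gives `2 (1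
+ κ)^(-m/2) = 2 (1 - s²)^(m/2) ≤ 2 exp (-s² m/2)`. One degree of freedom is lost, whence the `n - 1`
in the final bound. -/
lemma selfNormalized_coord_tail {m : ℕ} (i : Fin (m + 1)) {s : ℝ} :
    (stdPi (Fin (m + 1))).real {x | s ^ 2 * ∑ j, x j ^ 2 < x i ^ 2} ≤
      2 * Real.exp (-(s ^ 2 * m / 2)) := by
  rcases le_or_gt 1 (s ^ 2) with h1 | h1
  · have : {x : Fin (m + 1) → ℝ | s ^ 2 * ∑ j, x j ^ 2 < x i ^ 2} = ∅ := by
      ext x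
      simp only [Set.mem_ofPred_eq, Set.mem_empty_iff_false, iff_false, not_lt]
      have h2 : x i ^ 2 ≤ ∑ j, x j ^ 2 :=
        Finset.single_le_sum (f := fun j => x j ^ 2) (fun j _ => sq_nonneg _) (Finset.mem_univ i)
      nlinarith [sq_nonneg (x i)]
    rw [this]
    simp only [measureReal_empty]
    positivity
  set κ : ℝ := s ^ 2 / (1 - s ^ 2) with hκ_def
  have h1s : 0 < 1 - s ^ 2 := by linarith
  have hκ : 0 ≤ κ := by positivity
  have hsub : {x : Fin (m + 1) → ℝ | s ^ 2 * ∑ j, x j ^ 2 < x i ^ 2} ⊆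
      (MeasurableEquiv.piFinSuccAbove (fun _ => ℝ) i) ⁻¹'
        {p | κ * ∑ j, p.2 j ^ 2 < p.1 ^ 2} := by
    intro x hx
    simp only [Set.mem_ofPred_eq, Set.mem_preimage] at hx ⊢
    rw [Fin.sum_univ_succAbove _ i] at hx
    simp only [MeasurableEquiv.piFinSuccAbove, MeasurableEquiv.coe_mk, Fin.insertNthEquiv,
      Equiv.coe_fn_symm_mk, Fin.removeNth]
    rw [hκ_def, div_mul_eq_mul_div, div_lt_iff₀ h1s]
    linarith
  have hmeasS : MeasurableSet {p : ℝ × (Fin m → ℝ) | κ * ∑ j, p.2 j ^ 2 < p.1 ^ 2} := by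
    apply measurableSet_lt <;> fun_prop
  have hmp := measurePreserving_piFinSuccAbove (fun _ : Fin (m + 1) => gaussianReal 0 1) i
  have hint := integrable_exp_mul_sum_sq (ι := Fin m) Finset.univ (c := -(κ / 2)) (by linarith)
  have hb : (stdPi (Fin (m + 1))) {x | s ^ 2 * ∑ j, x j ^ 2 < x i ^ 2} ≤
      ENNReal.ofReal (∫ y, 2 * Real.exp (-(κ / 2) * ∑ j, y j ^ 2) ∂(stdPi (Fin m))) := by
    refine (measure_mono hsub).trans ?_
    rw [hmp.measure_preimage hmeasS.nullMeasurableSet, Measure.prod_apply_symm hmeasS,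
      ofReal_integral_eq_lintegral_ofReal (hint.const_mul 2)
        (ae_of_all _ fun y => by positivity)]
    refine lintegral_mono fun y => ?_
    rw [ENNReal.le_ofReal_iff_toReal_le (measure_ne_top _ _) (by positivity)]
    have hW : 0 ≤ κ * ∑ j, y j ^ 2 := by positivity
    have := gaussianReal_tail (√(κ * ∑ j, y j ^ 2)) (Real.sqrt_nonneg _)
    rw [Real.sq_sqrt hW] at this
    refine this.trans (le_of_eq ?_)
    congr 2
    ring
  have hb2 := ENNReal.toReal_mono ENNReal.ofReal_ne_top hb
  rw [ENNReal.toReal_ofReal (by positivity), integral_const_mul,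
    integral_exp_mul_sum_sq _ (by linarith)] at hb2
  refine hb2.trans ?_
  rw [inv_sqrt_pow_eq_exp (by linarith)]
  gcongr
  have hk1 : 1 - 2 * -(κ / 2) = (1 - s ^ 2)⁻¹ := by
    rw [hκ_def]; field_simp; ring
  rw [hk1, Real.log_inv, Finset.card_univ, Fintype.card_fin]
  have := Real.log_le_sub_one_of_pos h1s
  have hm : (0 : ℝ) ≤ m := by positivity
  nlinarith

/-- Rotation invariance of the standard Gaussian; it reduces orthonormal directions to coordinates.
-/
lemma measurePreserving_inner_orthonormalBasis
    (b : OrthonormalBasis ι ℝ (EuclideanSpace ℝ ι)) :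
    MeasurePreserving (fun (x : ι → ℝ) i => inner ℝ (b i) (WithLp.toLp 2 x))
      (stdPi ι) (stdPi ι) := by
  have hf : Measurable fun (y : EuclideanSpace ℝ ι) i => inner ℝ (b i) y := by fun_prop
  have hg : Measurable fun (x : ι → ℝ) => ∑ i, x i • b i := by fun_prop
  have ht : Measurable (WithLp.toLp 2 : (ι → ℝ) → EuclideanSpace ℝ ι) := by fun_prop
  refine ⟨by fun_prop, ?_⟩
  have h1 : (stdPi ι).map (WithLp.toLp 2) = (stdPi ι).map (fun x => ∑ i, x i • b i) := by
    rw [map_pi_eq_stdGaussian, stdGaussian_eq_map_pi_orthonormalBasis b]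
  have h2 := congrArg
    (fun μ => Measure.map (fun (y : EuclideanSpace ℝ ι) i => inner ℝ (b i) y) μ) h1
  rw [Measure.map_map hf ht, Measure.map_map hf hg] at h2
  refine Eq.trans h2 ?_
  convert Measure.map_id
  ext x i
  classical
  simp [inner_sum, inner_smul_right, orthonormal_iff_ite.1 b.orthonormal]

lemma exists_orthonormalBasis_extension [DecidableEq ι] {u : ι → ι → ℝ} {s : Finset ι}
    (hu : ∀ i ∈ s, ∀ j ∈ s, u i ⬝ᵥ u j = if i = j then 1 else 0) :
    ∃ b : OrthonormalBasis ι ℝ (EuclideanSpace ℝ ι), ∀ i ∈ s, b i = WithLp.toLp 2 (u i) := by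
  obtain ⟨b, hb⟩ := Orthonormal.exists_orthonormalBasis_extension_of_card_eq
    (𝕜 := ℝ) (E := EuclideanSpace ℝ ι) (ι := ι) (by simp) (v := fun i => WithLp.toLp 2 (u i))
    (s := (s : Set ι)) (by
      rw [orthonormal_iff_ite]
      rintro ⟨i, hi⟩ ⟨j, hj⟩
      have := hu i hi j hj
      simp only [Set.domRestrict_apply, EuclideanSpace.inner_toLp_toLp, star_trivial,
        Subtype.mk.injEq]
      rw [dotProduct_comm, this])
  exact ⟨b, fun i hi => hb i hi⟩

lemma orthonormal_chiSq_upper_tail [DecidableEq ι] {u : ι → ι → ℝ} {s : Finset ι} (hs : s.Nonempty)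
    (hu : ∀ i ∈ s, ∀ j ∈ s, u i ⬝ᵥ u j = if i = j then 1 else 0) {a : ℝ} (ha : 0 < a) :
    (stdPi ι).real {x | (√(s.card : ℝ) + √(2 * a)) ^ 2 ≤ ∑ i ∈ s, (u i ⬝ᵥ x) ^ 2} ≤
      Real.exp (-a) := by
  obtain ⟨b, hb⟩ := exists_orthonormalBasis_extension hu
  have hmp := measurePreserving_inner_orthonormalBasis b
  have hm : MeasurableSet {x : ι → ℝ | (√(s.card : ℝ) + √(2 * a)) ^ 2 ≤ ∑ i ∈ s, x i ^ 2} := by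
    apply measurableSet_le <;> fun_prop
  refine le_trans (le_of_eq ?_) (chiSq_upper_tail hs ha)
  rw [← hmp.measureReal_preimage hm.nullMeasurableSet]
  congr 1
  ext x
  simp only [Set.mem_ofPred_eq, Set.mem_preimage]
  rw [Finset.sum_congr rfl fun i hi => ?_]
  rw [hb i hi, EuclideanSpace.inner_toLp_toLp, star_trivial, dotProduct_comm]

lemma selfNormalized_tail {n : ℕ} {u : Fin n → ℝ} (hu : u ⬝ᵥ u = 1) {s : ℝ} :
    (stdPi (Fin n)).real {x | s ^ 2 * ∑ j, x j ^ 2 < (u ⬝ᵥ x) ^ 2} ≤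
      2 * Real.exp (-(s ^ 2 * ((n : ℝ) - 1) / 2)) := by
  rcases n with _ | m
  · simp at hu
  obtain ⟨b, hb⟩ := exists_orthonormalBasis_extension (u := fun _ => u) (s := {(0 : Fin (m + 1))})
    (by simp [hu])
  have hmp := measurePreserving_inner_orthonormalBasis b
  have hm : MeasurableSet {x : Fin (m + 1) → ℝ | s ^ 2 * ∑ j, x j ^ 2 < x 0 ^ 2} := by
    apply measurableSet_lt <;> fun_prop
  have := selfNormalized_coord_tail (0 : Fin (m + 1)) (s := s)
  rw [← hmp.measureReal_preimage hm.nullMeasurableSet] at this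
  push_cast
  rw [add_sub_cancel_right]
  refine le_trans (le_of_eq ?_) this
  congr 1
  ext x
  simp only [Set.mem_ofPred_eq, Set.mem_preimage]
  rw [b.sum_sq_inner_right, hb 0 (by simp), EuclideanSpace.inner_toLp_toLp, star_trivial,
    dotProduct_comm, EuclideanSpace.real_norm_sq_eq]

end Gaussian


/-- A finite set closed under predecessors is an initial segment; applied to the positions of the
points on one arc. -/
lemma finset_nat_eq_range_card {A : Finset ℕ} (h : ∀ k, k + 1 ∈ A → k ∈ A) :
    A = Finset.range A.card := by
  have hdown : ∀ d k, k + d ∈ A → k ∈ A := by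
    intro d
    induction d with
    | zero => exact fun k hk => hk
    | succ d ih => exact fun k hk => ih k (h (k + d) hk)
  refine Finset.eq_of_subset_of_card_le (fun k hk => ?_) (by simp)
  have hsub : Finset.range (k + 1) ⊆ A := by
    intro i hi
    have hi' : i ≤ k := by simpa [Nat.lt_succ_iff] using hi
    refine hdown (k - i) i ?_
    rwa [Nat.add_sub_cancel' hi']
  have := Finset.card_le_card hsub
  simp only [Finset.card_range] at this
  exact Finset.mem_range.2 this

/-! ### One-dimensional profiles on an arc -/

section Profile

/-- The squared norm of the centered step with `k` ones among `m` points. -/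
noncomputable def stepSq (m k : ℕ) : ℝ := k * ((m : ℝ) - k) / m

lemma stepSq_nonneg {m k : ℕ} (h : k ≤ m) : 0 ≤ stepSq m k := by
  have : (k : ℝ) ≤ m := by exact_mod_cast h
  have : 0 ≤ (m : ℝ) - k := by linarith
  unfold stepSq
  positivity

lemma stepSq_le (m k : ℕ) : stepSq m k ≤ m / 4 := by
  unfold stepSq
  rcases Nat.eq_zero_or_pos m with rfl | hm
  · simp
  have : (0 : ℝ) < m := by exact_mod_cast hm
  rw [div_le_iff₀ this]
  nlinarith [sq_nonneg ((m : ℝ) - 2 * k)]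

/-- From `(√A - √B)² (A + B) ≤ (A - B)²` the claim becomes rational in `k` and `j = m - k - 1`. The
bound has harmonic form, so its sum over an arc is logarithmic. -/
lemma sq_sqrt_stepSq_succ_sub {m k : ℕ} (hm : 2 ≤ m) (hk : k < m) :
    (√(stepSq m (k + 1)) - √(stepSq m k)) ^ 2 ≤ 1 / ((k : ℝ) + 1) + 1 / ((m : ℝ) - k) := by
  obtain ⟨j, rfl⟩ : ∃ j, m = k + 1 + j := ⟨m - (k + 1), by omega⟩
  set A := stepSq (k + 1 + j) (k + 1) with hA
  set B := stepSq (k + 1 + j) k with hB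
  have hA0 : 0 ≤ A := stepSq_nonneg (by omega)
  have hB0 : 0 ≤ B := stepSq_nonneg (by omega)
  have hk0 : (0 : ℝ) ≤ k := by positivity
  have hj0 : (0 : ℝ) ≤ j := by positivity
  have hm0 : (0 : ℝ) < k + 1 + j := by positivity
  have hA' : A = (k + 1) * j / (k + 1 + j) := by
    rw [hA, stepSq]; push_cast; congr 1; ring
  have hB' : B = k * (j + 1) / (k + 1 + j) := by
    rw [hB, stepSq]; push_cast; congr 1; ring
  have hsum : A + B = (2 * (k * j) + k + j) / (k + 1 + j) := by
    rw [hA', hB']; field_simp; ring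
  have hkj : 1 ≤ k + j := by omega
  have hkj' : (1 : ℝ) ≤ k + j := by exact_mod_cast hkj
  have hsum0 : 0 < A + B := by
    rw [hsum]
    have : (0 : ℝ) ≤ k * j := by positivity
    have : (0 : ℝ) < 2 * (k * j) + k + j := by linarith
    positivity
  have hdiff : A - B = ((j : ℝ) - k) / (k + 1 + j) := by
    rw [hA', hB']; field_simp; ring
  have h1 : (√A - √B) ^ 2 * (A + B) ≤ (A - B) ^ 2 := by
    have e1 := Real.sq_sqrt hA0
    have e2 := Real.sq_sqrt hB0
    have e3 : A - B = (√A - √B) * (√A + √B) := by linear_combination -e1 + e2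
    have e4 : A + B ≤ (√A + √B) ^ 2 := by
      nlinarith [mul_nonneg (Real.sqrt_nonneg A) (Real.sqrt_nonneg B)]
    rw [e3, mul_pow]
    exact mul_le_mul_of_nonneg_left e4 (sq_nonneg _)
  have h2 : (√A - √B) ^ 2 ≤ (A - B) ^ 2 / (A + B) := (le_div_iff₀ hsum0).2 h1
  refine h2.trans ?_
  have e : (A - B) ^ 2 / (A + B)
      = ((j : ℝ) - k) ^ 2 / ((k + 1 + j) * (2 * (k * j) + k + j)) := by
    rw [hsum, hdiff]; field_simp
  rw [e]
  have hr : 1 / ((k : ℝ) + 1) + 1 / (((k + 1 + j : ℕ) : ℝ) - k)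
      = (k + j + 2) / ((k + 1) * (j + 1)) := by
    push_cast
    have : (k : ℝ) + 1 + j - k = j + 1 := by ring
    rw [this]
    field_simp
    ring
  rw [hr]
  have hden : (0 : ℝ) < (k + 1 + j) * (2 * (k * j) + k + j) := by
    have : (0 : ℝ) ≤ k * j := by positivity
    have : (0 : ℝ) < 2 * (k * j) + k + j := by linarith
    positivity
  rw [div_le_div_iff₀ hden (by positivity)]
  rcases Nat.eq_zero_or_pos k with rfl | hk1
  · push_cast
    nlinarith [mul_nonneg hj0 hj0, pow_nonneg hj0 3]
  rcases Nat.eq_zero_or_pos j with rfl | hj1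
  · push_cast
    nlinarith [mul_nonneg hk0 hk0, pow_nonneg hk0 3]
  have hkj1 : (1 : ℝ) ≤ k * j := by exact_mod_cast Nat.mul_pos hk1 hj1
  have f1 : ((j : ℝ) - k) ^ 2 ≤ (k + j + 2) * (k + 1 + j) := by nlinarith
  have f2 : ((k : ℝ) + 1) * (j + 1) ≤ 2 * (k * j) + k + j := by linarith
  calc ((j : ℝ) - k) ^ 2 * ((k + 1) * (j + 1))
      ≤ ((k + j + 2) * (k + 1 + j)) * (2 * (k * j) + k + j) := by gcongr
    _ = _ := by ring

lemma sum_sq_sqrt_stepSq_succ_sub {m : ℕ} (hm : 2 ≤ m) :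
    ∑ k ∈ Finset.range m, (√(stepSq m (k + 1)) - √(stepSq m k)) ^ 2 ≤ 5 * Real.log m := by
  have h1 : ∑ k ∈ Finset.range m, (1 : ℝ) / ((k : ℝ) + 1) ≤ 1 + Real.log m := by
    have := harmonic_le_one_add_log m
    rw [harmonic] at this
    push_cast at this
    simpa using this
  have h2 : ∑ k ∈ Finset.range m, (1 : ℝ) / ((m : ℝ) - k)
      = ∑ k ∈ Finset.range m, (1 : ℝ) / ((k : ℝ) + 1) := by
    rw [← Finset.sum_range_reflect]
    refine Finset.sum_congr rfl fun k hk => ?_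
    have hk' := Finset.mem_range.1 hk
    congr 1
    have : ((m - 1 - k : ℕ) : ℝ) = (m : ℝ) - 1 - k := by
      rw [Nat.cast_sub (by omega), Nat.cast_sub (by omega)]; simp
    rw [this]; ring
  have h3 : ∑ k ∈ Finset.range m, (√(stepSq m (k + 1)) - √(stepSq m k)) ^ 2 ≤
      ∑ k ∈ Finset.range m, ((1 : ℝ) / ((k : ℝ) + 1) + 1 / ((m : ℝ) - k)) :=
    Finset.sum_le_sum fun k hk => sq_sqrt_stepSq_succ_sub hm (Finset.mem_range.1 hk)
  rw [Finset.sum_add_distrib, h2] at h3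
  -- The harmonic sums give `2 + 2 log m`, and `2 ≤ 3 log 2 ≤ 3 log m`.
  have h4 : Real.log 2 ≤ Real.log m := Real.log_le_log (by norm_num) (by exact_mod_cast hm)
  have := Real.log_two_gt_d9
  linarith

/-- The function on `0, …, m` that goes linearly from `s₂` to `0` on `0, …, ⌊m/2⌋` and then
linearly from `0` to `s₁`. -/
noncomputable def tent (m : ℕ) (s₁ s₂ : ℝ) (k : ℕ) : ℝ :=
  if k ≤ m / 2 then s₂ * (1 - k / (m / 2 : ℕ))
  else s₁ * (((k : ℝ) - (m / 2 : ℕ)) / ((m + 1) / 2 : ℕ))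

/-- The slope of `tent`. -/
noncomputable def tentSlope (m k : ℕ) : ℝ :=
  if k < m / 2 then 1 / ((m / 2 : ℕ) : ℝ) else 1 / (((m + 1) / 2 : ℕ) : ℝ)

lemma tent_zero (m : ℕ) (s₁ s₂ : ℝ) : tent m s₁ s₂ 0 = s₂ := by simp [tent]

lemma cast_half_add (m : ℕ) : ((m / 2 : ℕ) : ℝ) + (((m + 1) / 2 : ℕ) : ℝ) = m := by
  have : m / 2 + (m + 1) / 2 = m := by omega
  exact_mod_cast this

lemma tent_self {m : ℕ} (hm : 2 ≤ m) (s₁ s₂ : ℝ) : tent m s₁ s₂ m = s₁ := by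
  have h : ¬ m ≤ m / 2 := by omega
  have h2 : (((m + 1) / 2 : ℕ) : ℝ) ≠ 0 := by
    have : (m + 1) / 2 ≠ 0 := by omega
    exact_mod_cast this
  have := cast_half_add m
  rw [tent, if_neg h, show (m : ℝ) - (m / 2 : ℕ) = ((m + 1) / 2 : ℕ) by linarith, div_self h2,
    mul_one]

lemma tent_of_half_le {m k : ℕ} (hm : 2 ≤ m) (hk : m / 2 ≤ k) (s₁ s₂ : ℝ) :
    tent m s₁ s₂ k = s₁ * (((k : ℝ) - (m / 2 : ℕ)) / ((m + 1) / 2 : ℕ)) := by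
  rw [tent]
  split_ifs with h
  · obtain rfl : k = m / 2 := le_antisymm h hk
    have : ((m / 2 : ℕ) : ℝ) ≠ 0 := by
      have : m / 2 ≠ 0 := by omega
      exact_mod_cast this
    simp [div_self this]
  · rfl

lemma abs_tent_le_one {m k : ℕ} (hm : 2 ≤ m) (hk : k ≤ m) {s₁ s₂ : ℝ} (h₁ : |s₁| ≤ 1)
    (h₂ : |s₂| ≤ 1) : |tent m s₁ s₂ k| ≤ 1 := by
  have hp : (0 : ℝ) < (m / 2 : ℕ) := by
    have : 0 < m / 2 := by omega
    exact_mod_cast this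
  have hp' : (0 : ℝ) < ((m + 1) / 2 : ℕ) := by
    have : 0 < (m + 1) / 2 := by omega
    exact_mod_cast this
  have := cast_half_add m
  have hkm : (k : ℝ) ≤ m := by exact_mod_cast hk
  rcases le_total k (m / 2) with h | h
  · have h' : (k : ℝ) ≤ (m / 2 : ℕ) := by exact_mod_cast h
    have e : |1 - (k : ℝ) / (m / 2 : ℕ)| ≤ 1 := by
      have h0 : 0 ≤ (k : ℝ) / (m / 2 : ℕ) := by positivity
      have h1 : (k : ℝ) / (m / 2 : ℕ) ≤ 1 := (div_le_one hp).2 h'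
      rw [abs_le]
      constructor <;> linarith
    rw [tent, if_pos h, abs_mul]
    exact mul_le_one₀ h₂ (abs_nonneg _) e
  · have h' : ((m / 2 : ℕ) : ℝ) ≤ k := by exact_mod_cast h
    have e : |((k : ℝ) - (m / 2 : ℕ)) / ((m + 1) / 2 : ℕ)| ≤ 1 := by
      rw [abs_of_nonneg (div_nonneg (by linarith) hp'.le)]
      exact (div_le_one hp').2 (by linarith)
    rw [tent_of_half_le hm h, abs_mul]
    exact mul_le_one₀ h₁ (abs_nonneg _) e

lemma abs_tent_succ_sub_le {m k : ℕ} (hm : 2 ≤ m) {s₁ s₂ : ℝ} (h₁ : |s₁| ≤ 1)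
    (h₂ : |s₂| ≤ 1) : |tent m s₁ s₂ (k + 1) - tent m s₁ s₂ k| ≤ tentSlope m k := by
  rcases lt_or_ge k (m / 2) with h | h
  · rw [tent, if_pos (by omega), tent, if_pos h.le, tentSlope, if_pos h]
    have e : s₂ * (1 - ((k + 1 : ℕ) : ℝ) / (m / 2 : ℕ)) - s₂ * (1 - (k : ℝ) / (m / 2 : ℕ))
        = -s₂ * (1 / (m / 2 : ℕ)) := by push_cast; ring
    rw [e, abs_mul, abs_neg, abs_of_nonneg (by positivity : (0 : ℝ) ≤ 1 / (m / 2 : ℕ))]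
    exact mul_le_of_le_one_left (by positivity) h₂
  · rw [tent_of_half_le hm (by omega), tent_of_half_le hm h, tentSlope, if_neg (by omega)]
    have e : s₁ * ((((k + 1 : ℕ) : ℝ) - (m / 2 : ℕ)) / ((m + 1) / 2 : ℕ))
        - s₁ * (((k : ℝ) - (m / 2 : ℕ)) / ((m + 1) / 2 : ℕ))
        = s₁ * (1 / ((m + 1) / 2 : ℕ)) := by push_cast; ring
    rw [e, abs_mul, abs_of_nonneg (by positivity : (0 : ℝ) ≤ 1 / ((m + 1) / 2 : ℕ))]
    exact mul_le_of_le_one_left (by positivity) h₁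

lemma sum_tentSlope_sq {m : ℕ} (hm : 2 ≤ m) :
    ∑ k ∈ Finset.range m, tentSlope m k ^ 2
      = 1 / ((m / 2 : ℕ) : ℝ) + 1 / (((m + 1) / 2 : ℕ) : ℝ) := by
  have hp : ((m / 2 : ℕ) : ℝ) ≠ 0 := by
    have : m / 2 ≠ 0 := by omega
    exact_mod_cast this
  have hp' : (((m + 1) / 2 : ℕ) : ℝ) ≠ 0 := by
    have : (m + 1) / 2 ≠ 0 := by omega
    exact_mod_cast this
  have hsplit := Finset.sum_range_add_sum_Ico (fun k => tentSlope m k ^ 2)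
    (show m / 2 ≤ m by omega)
  rw [← hsplit]
  congr 1
  · rw [Finset.sum_congr rfl (g := fun _ => (1 / ((m / 2 : ℕ) : ℝ)) ^ 2)]
    · rw [Finset.sum_const, Finset.card_range, nsmul_eq_mul]
      field_simp
    · intro k hk
      rw [tentSlope, if_pos (Finset.mem_range.1 hk)]
  · rw [Finset.sum_congr rfl (g := fun _ => (1 / (((m + 1) / 2 : ℕ) : ℝ)) ^ 2)]
    · rw [Finset.sum_const, Nat.card_Ico, show m - m / 2 = (m + 1) / 2 by omega, nsmul_eq_mul]
      field_simp
    · intro k hk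
      rw [tentSlope, if_neg (by have := (Finset.mem_Ico.1 hk).1; omega)]

end Profile


/-! ### Arcs of a permutation cut at `S`, and the centered steps -/

section Arc

variable {V : Type*} (T : Equiv.Perm V) (S : Finset V)

/-- The number of steps of `T` needed to reach `S` from `v`. -/
noncomputable def arcPos (v : V) : ℕ := sInf {k | (T ^ k) v ∈ S}

/-- The first point of `S` on the forward orbit of `v` under `T`. -/
noncomputable def arcHead (v : V) : V := (T ^ arcPos T S v) v

/-- The number of points whose forward orbit meets `S` first in `s`. -/
noncomputable def arcSize [Fintype V] [DecidableEq V] (s : V) : ℕ :=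
  (Finset.univ.filter fun v => arcHead T S v = s).card

variable {T S}

lemma arcHead_mem (hr : ∀ v, ∃ k : ℕ, (T ^ k) v ∈ S) (v : V) : arcHead T S v ∈ S :=
  Nat.sInf_mem (hr v)

lemma arcPos_of_mem {v : V} (hv : v ∈ S) : arcPos T S v = 0 :=
  Nat.sInf_eq_zero.2 (Or.inl (by simpa using hv))

lemma arcHead_of_mem {v : V} (hv : v ∈ S) : arcHead T S v = v := by
  simp [arcHead, arcPos_of_mem hv]

/-- Reachability matters here: the infimum of the empty set is also 0. -/
lemma mem_of_arcPos_eq_zero (hr : ∀ v, ∃ k : ℕ, (T ^ k) v ∈ S) {v : V}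
    (hv : arcPos T S v = 0) : v ∈ S := by
  have := arcHead_mem hr v
  rwa [arcHead, hv, pow_zero, Equiv.Perm.one_apply] at this

lemma arcPos_of_notMem (hr : ∀ v, ∃ k : ℕ, (T ^ k) v ∈ S) {v : V} (hv : v ∉ S) :
    arcPos T S v = arcPos T S (T v) + 1 := by
  apply le_antisymm
  · refine Nat.sInf_le ?_
    have := arcHead_mem hr (T v)
    rw [arcHead] at this
    simpa [pow_succ] using this
  · have h0 : arcPos T S v ≠ 0 := fun h => hv (mem_of_arcPos_eq_zero hr h)
    obtain ⟨k, hk⟩ := Nat.exists_eq_succ_of_ne_zero h0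
    have := arcHead_mem hr v
    rw [arcHead, hk, Nat.succ_eq_add_one, pow_succ, Equiv.Perm.mul_apply] at this
    have : arcPos T S (T v) ≤ k := Nat.sInf_le this
    omega

lemma arcHead_of_notMem (hr : ∀ v, ∃ k : ℕ, (T ^ k) v ∈ S) {v : V} (hv : v ∉ S) :
    arcHead T S v = arcHead T S (T v) := by
  rw [arcHead, arcHead, arcPos_of_notMem hr hv, pow_succ, Equiv.Perm.mul_apply]

lemma eq_of_arcHead_eq_of_arcPos_eq {v w : V} (h : arcHead T S v = arcHead T S w)
    (hp : arcPos T S v = arcPos T S w) : v = w := by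
  rw [arcHead, arcHead, hp] at h
  exact (T ^ arcPos T S w).injective h

lemma arcPos_symm_of_notMem (hr : ∀ v, ∃ k : ℕ, (T ^ k) v ∈ S) {v : V} (hv : T.symm v ∉ S) :
    arcPos T S (T.symm v) = arcPos T S v + 1 := by
  simpa using arcPos_of_notMem hr hv

lemma arcHead_symm_of_notMem (hr : ∀ v, ∃ k : ℕ, (T ^ k) v ∈ S) {v : V} (hv : T.symm v ∉ S) :
    arcHead T S (T.symm v) = arcHead T S v := by
  simpa using arcHead_of_notMem hr hv

/-- Summation by parts; a permutation has no boundary terms. -/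
lemma sum_mul_symm_sub [Fintype V] (h z : V → ℝ) :
    ∑ v, h v * (z (T.symm v) - z v) = ∑ e, z e * (h (T e) - h e) := by
  have h1 : ∑ v, h v * z (T.symm v) = ∑ e, h (T e) * z e := by
    rw [← Equiv.sum_comp T]; simp
  simp only [mul_sub, Finset.sum_sub_distrib, h1]
  congr 1 <;> exact Finset.sum_congr rfl fun _ _ => mul_comm _ _

variable [Fintype V] [DecidableEq V]

lemma image_arcPos_fiber (hr : ∀ v, ∃ k : ℕ, (T ^ k) v ∈ S) (s : V) :
    (Finset.univ.filter fun v => arcHead T S v = s).image (arcPos T S)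
      = Finset.range (arcSize T S s) := by
  have hinj : Set.InjOn (arcPos T S) (Finset.univ.filter fun v => arcHead T S v = s) := by
    intro v hv w hw h
    simp only [Finset.coe_filter, Finset.mem_univ, true_and, Set.mem_ofPred_eq] at hv hw
    exact eq_of_arcHead_eq_of_arcPos_eq (hv.trans hw.symm) h
  rw [arcSize, ← Finset.card_image_of_injOn hinj]
  apply finset_nat_eq_range_card
  intro k hk
  simp only [Finset.mem_image, Finset.mem_filter, Finset.mem_univ, true_and] at hk ⊢
  obtain ⟨v, hv, hvk⟩ := hk
  have hvS : v ∉ S := fun h => by rw [arcPos_of_mem h] at hvk; omega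
  refine ⟨T v, ?_, ?_⟩
  · rw [← arcHead_of_notMem hr hvS, hv]
  · have := arcPos_of_notMem hr hvS
    omega

lemma sum_fiber_arcPos (hr : ∀ v, ∃ k : ℕ, (T ^ k) v ∈ S) (s : V) (F : ℕ → ℝ) :
    ∑ v ∈ Finset.univ.filter (fun v => arcHead T S v = s), F (arcPos T S v)
      = ∑ k ∈ Finset.range (arcSize T S s), F k := by
  rw [← image_arcPos_fiber hr s, Finset.sum_image]
  intro v hv w hw h
  simp only [Finset.coe_filter, Finset.mem_univ, true_and, Set.mem_ofPred_eq] at hv hw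
  exact eq_of_arcHead_eq_of_arcPos_eq (hv.trans hw.symm) h

lemma sum_arcHead_arcPos (hr : ∀ v, ∃ k : ℕ, (T ^ k) v ∈ S) (F : V → ℕ → ℝ) :
    ∑ v, F (arcHead T S v) (arcPos T S v)
      = ∑ s ∈ S, ∑ k ∈ Finset.range (arcSize T S s), F s k := by
  rw [← Finset.sum_fiberwise_of_maps_to (s := Finset.univ) (t := S) (g := arcHead T S)
    (fun v _ => arcHead_mem hr v)]
  refine Finset.sum_congr rfl fun s _ => ?_
  rw [← sum_fiber_arcPos hr s]
  refine Finset.sum_congr rfl fun v hv => ?_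
  rw [(Finset.mem_filter.1 hv).2]

lemma sum_arcSize (hr : ∀ v, ∃ k : ℕ, (T ^ k) v ∈ S) :
    ∑ s ∈ S, (arcSize T S s : ℝ) = Fintype.card V := by
  have := sum_arcHead_arcPos hr (fun _ _ => 1)
  simpa using this.symm

lemma arcPos_lt_arcSize (hr : ∀ v, ∃ k : ℕ, (T ^ k) v ∈ S) (v : V) :
    arcPos T S v < arcSize T S (arcHead T S v) := by
  rw [← Finset.mem_range, ← image_arcPos_fiber hr]
  exact Finset.mem_image_of_mem _ (by simp)

lemma exists_arcPos_eq (hr : ∀ v, ∃ k : ℕ, (T ^ k) v ∈ S) {s : V} {k : ℕ}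
    (hk : k < arcSize T S s) : ∃ v, arcHead T S v = s ∧ arcPos T S v = k := by
  rw [← Finset.mem_range, ← image_arcPos_fiber hr] at hk
  simpa using hk

/-- If the edge into `v` is cut, then `v` is the farthest point of its arc: a point at the next
position would be the predecessor of `v`, which is in `S`. -/
lemma arcPos_add_one_of_symm_mem (hr : ∀ v, ∃ k : ℕ, (T ^ k) v ∈ S) {v : V}
    (hv : T.symm v ∈ S) : arcPos T S v + 1 = arcSize T S (arcHead T S v) := by
  refine le_antisymm (arcPos_lt_arcSize hr v) ?_
  by_contra! h
  obtain ⟨w, hw, hwk⟩ := exists_arcPos_eq hr h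
  have hwS : w ∉ S := fun h => by rw [arcPos_of_mem h] at hwk; omega
  have h1 := arcPos_of_notMem hr hwS
  have h2 := arcHead_of_notMem hr hwS
  have : T w = v := eq_of_arcHead_eq_of_arcPos_eq (h2.symm.trans hw) (by omega)
  rw [← this, Equiv.symm_apply_apply] at hv
  exact hwS hv

variable (T S) in
/-- The last point of `S` on the backward orbit of `s` before the arc that ends in `s`. -/
noncomputable def arcTail (s : V) : V := (T ^ arcSize T S s).symm s

lemma symm_eq_arcTail (hr : ∀ v, ∃ k : ℕ, (T ^ k) v ∈ S) {v : V} (hv : T.symm v ∈ S) :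
    T.symm v = arcTail T S (arcHead T S v) := by
  rw [arcTail, Equiv.eq_symm_apply, ← arcPos_add_one_of_symm_mem hr hv, pow_succ,
    Equiv.Perm.mul_apply, Equiv.apply_symm_apply, arcHead]

variable (T S) in
/-- The centered indicator of the part of the arc of `e` that lies after `e`. -/
noncomputable def arcStep (e w : V) : ℝ :=
  if arcHead T S w = arcHead T S e then
    (if arcPos T S w < arcPos T S e then 1 else 0)
      - (arcPos T S e : ℝ) / arcSize T S (arcHead T S e)
  else 0

lemma arcStep_of_mem {e : V} (he : e ∈ S) (w : V) : arcStep T S e w = 0 := by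
  simp [arcStep, arcPos_of_mem he]

/-- Consecutive steps differ by the unit vector at `v` minus averaging over its arc. Thus the inner
products with the steps are a discrete primitive of `x` minus its arc means. At a cut edge the step
vanishes, and the formula persists. -/
lemma arcStep_symm_sub (hr : ∀ v, ∃ k : ℕ, (T ^ k) v ∈ S) (v w : V) :
    arcStep T S (T.symm v) w - arcStep T S v w
      = (if w = v then 1 else 0)
        - (if arcHead T S w = arcHead T S v then
            1 / (arcSize T S (arcHead T S v) : ℝ) else 0) := by
  have hpos : ∀ {w}, arcHead T S w = arcHead T S v → (w = v ↔ arcPos T S w = arcPos T S v) :=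
    fun h => ⟨fun h' => by rw [h'], eq_of_arcHead_eq_of_arcPos_eq h⟩
  have hm : (0 : ℝ) < arcSize T S (arcHead T S v) := by
    exact_mod_cast (Nat.zero_le _).trans_lt (arcPos_lt_arcSize hr v)
  by_cases hv : T.symm v ∈ S
  · rw [arcStep_of_mem hv, zero_sub, arcStep]
    by_cases hw : arcHead T S w = arcHead T S v
    · have h1 := arcPos_add_one_of_symm_mem hr hv
      have h2 := arcPos_lt_arcSize hr w
      rw [hw] at h2
      simp only [hw, if_true]
      have h3 : (arcPos T S v : ℝ) = arcSize T S (arcHead T S v) - 1 := by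
        rw [← h1]; simp
      have h4 : (arcPos T S v : ℝ) / arcSize T S (arcHead T S v)
          = 1 - 1 / arcSize T S (arcHead T S v) := by
        rw [h3]; field_simp
      rw [h4]
      by_cases hwv : w = v
      · simp [hwv]
      · have : arcPos T S w ≠ arcPos T S v := fun h => hwv ((hpos hw).2 h)
        have : arcPos T S w < arcPos T S v := by omega
        simp [hwv, this]
    · have : w ≠ v := fun h => hw (by rw [h])
      simp [hw, this]
  · rw [arcStep, arcStep, arcHead_symm_of_notMem hr hv, arcPos_symm_of_notMem hr hv]
    by_cases hw : arcHead T S w = arcHead T S v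
    · simp only [hw, if_true]
      by_cases hwv : w = v
      · simp [hwv]; ring
      · have hne : arcPos T S w ≠ arcPos T S v := fun h => hwv ((hpos hw).2 h)
        have : arcPos T S w < arcPos T S v + 1 ↔ arcPos T S w < arcPos T S v := by omega
        simp only [hwv, if_false, this]
        push_cast
        ring
    · have : w ≠ v := fun h => hw (by rw [h])
      simp [hw, this]

lemma sum_arcStep_sq (hr : ∀ v, ∃ k : ℕ, (T ^ k) v ∈ S) (e : V) :
    ∑ w, arcStep T S e w ^ 2 = stepSq (arcSize T S (arcHead T S e)) (arcPos T S e) := by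
  set m := arcSize T S (arcHead T S e) with hm_def
  set k := arcPos T S e with hk_def
  have hkm : k < m := arcPos_lt_arcSize hr e
  have hm : (0 : ℝ) < m := by exact_mod_cast (Nat.zero_le _).trans_lt hkm
  set F : ℕ → ℝ := fun i => (if i < k then 1 - 2 * ((k : ℝ) / m) else 0) + ((k : ℝ) / m) ^ 2
    with hF
  have h1 : ∀ w, arcStep T S e w ^ 2 =
      if arcHead T S w = arcHead T S e then F (arcPos T S w) else 0 := by
    intro w
    simp only [arcStep, hF, ← hk_def, ← hm_def]
    split_ifs <;> ring
  simp_rw [h1]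
  rw [← Finset.sum_filter, sum_fiber_arcPos hr, hF, Finset.sum_add_distrib, ← Finset.sum_filter]
  have h2 : (Finset.range (arcSize T S (arcHead T S e))).filter (· < k) = Finset.range k := by
    ext i
    simp only [Finset.mem_filter, Finset.mem_range]
    omega
  rw [h2]
  simp only [Finset.sum_const, Finset.card_range, nsmul_eq_mul]
  rw [stepSq, ← hm_def]
  field_simp
  ring

variable (T S) in
/-- The mean of `x` over the arc that ends in `s`. -/
noncomputable def arcMean (x : V → ℝ) (s : V) : ℝ :=
  (∑ v ∈ Finset.univ.filter (fun v => arcHead T S v = s), x v) / arcSize T S s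

/-- Decomposition of the inner product with `h` into the part from the functions that are constant
on arcs and the part from the increments of `h`. -/
lemma dotProduct_eq_arcMean_add_arcStep (hr : ∀ v, ∃ k : ℕ, (T ^ k) v ∈ S) (x h : V → ℝ) :
    x ⬝ᵥ h = (∑ v, arcMean T S x (arcHead T S v) * h v)
      + ∑ e ∈ Sᶜ, (h (T e) - h e) * (arcStep T S e ⬝ᵥ x) := by
  have hz : ∀ v, (arcStep T S (T.symm v) ⬝ᵥ x) - (arcStep T S v ⬝ᵥ x)
      = x v - arcMean T S x (arcHead T S v) := by
    intro v
    rw [← sub_dotProduct]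
    simp only [dotProduct, Pi.sub_apply, arcStep_symm_sub hr, sub_mul, ite_mul, one_mul, zero_mul,
      Finset.sum_sub_distrib, Finset.sum_ite_eq', Finset.mem_univ, if_true]
    rw [← Finset.sum_filter, ← Finset.mul_sum, arcMean]
    ring
  have h1 := sum_mul_symm_sub (T := T) h (fun e => arcStep T S e ⬝ᵥ x)
  simp only [hz] at h1
  have h2 : ∑ e, (arcStep T S e ⬝ᵥ x) * (h (T e) - h e)
      = ∑ e ∈ Sᶜ, (h (T e) - h e) * (arcStep T S e ⬝ᵥ x) := by
    rw [← Finset.sum_add_sum_compl S, Finset.sum_eq_zero (s := S), zero_add]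
    · exact Finset.sum_congr rfl fun _ _ => mul_comm _ _
    · intro e he
      simp [dotProduct, arcStep_of_mem he]
  rw [← h2, ← h1, ← Finset.sum_add_distrib, dotProduct]
  exact Finset.sum_congr rfl fun _ _ => by ring

lemma sum_arcMean_sq (hr : ∀ v, ∃ k : ℕ, (T ^ k) v ∈ S) (x : V → ℝ) :
    ∑ v, arcMean T S x (arcHead T S v) ^ 2 = ∑ s ∈ S, arcSize T S s * arcMean T S x s ^ 2 := by
  rw [sum_arcHead_arcPos hr (fun s _ => arcMean T S x s ^ 2)]
  simp

end Arc

/-! ### Compatibility with noise weights, by a dual certificate -/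

section Compatibility

variable {V : Type*} {T : Equiv.Perm V} {S : Finset V} [Fintype V] [DecidableEq V]

lemma abs_mul_one_sub_sub_le {t t' b b' θ : ℝ} (hθ : 0 ≤ θ) (ht : |t| ≤ 1)
    (hb0 : 0 ≤ θ * b') (hb1 : θ * b' ≤ 1) :
    |t' * (1 - θ * b') - t * (1 - θ * b)| ≤ |t' - t| + θ * |b' - b| := by
  have e : t' * (1 - θ * b') - t * (1 - θ * b)
      = (t' - t) * (1 - θ * b') - t * (θ * (b' - b)) := by ring
  rw [e]
  refine (abs_sub _ _).trans (add_le_add ?_ ?_)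
  · rw [abs_mul]
    refine mul_le_of_le_one_right (abs_nonneg _) ?_
    rw [abs_of_nonneg] <;> linarith
  · rw [abs_mul, abs_mul, abs_of_nonneg hθ]
    exact mul_le_of_le_one_left (by positivity) ht

/-- Let `q` equal the sign of the increment of `h` on `S` and satisfy `|q| ≤ 1 - θ √stepSq` off `S`.
The left side is then at most the pairing of `q` with the increments of `h`. Summation by parts and
Cauchy–Schwarz bound this by the norm of the increments of `q` times that of `h`. -/
lemma compatibility_arc (hr : ∀ v, ∃ k : ℕ, (T ^ k) v ∈ S)
    (hsize : ∀ s ∈ S, 2 ≤ arcSize T S s) {θ : ℝ} (hθ : 0 ≤ θ)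
    (hθ1 : ∀ s ∈ S, θ * √(arcSize T S s : ℝ) ≤ 2) (h : V → ℝ) :
    ∑ e ∈ S, |h (T e) - h e| - ∑ e ∈ Sᶜ,
        (1 - θ * √(stepSq (arcSize T S (arcHead T S e)) (arcPos T S e))) * |h (T e) - h e|
      ≤ (√(∑ s ∈ S, (1 / ((arcSize T S s / 2 : ℕ) : ℝ) + 1 / (((arcSize T S s + 1) / 2 : ℕ) : ℝ)))
          + θ * √(∑ s ∈ S, 5 * Real.log (arcSize T S s))) * √(∑ v, h v ^ 2) := by
  set M : V → ℕ := fun v => arcSize T S (arcHead T S v) with hM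
  set δ : V → ℝ := fun e => h (T e) - h e with hδ
  have hω : ∀ s ∈ S, ∀ k, θ * √(stepSq (arcSize T S s) k) ≤ 1 := by
    intro s hs k
    have h1 : √(stepSq (arcSize T S s) k) ≤ √(arcSize T S s : ℝ) / 2 := by
      rw [show √(arcSize T S s : ℝ) / 2 = √((arcSize T S s : ℝ) / 4) by
        rw [Real.sqrt_div' _ (by norm_num), show (4 : ℝ) = 2 ^ 2 by norm_num,
          Real.sqrt_sq (by norm_num)]]
      exact Real.sqrt_le_sqrt (stepSq_le _ _)
    have h2 := hθ1 s hs
    have h3 := mul_le_mul_of_nonneg_left h1 hθ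
    linarith
  have hsgn : ∀ x : ℝ, |(SignType.sign x : ℝ)| ≤ 1 := by
    intro x
    rcases lt_trichotomy x 0 with hx | rfl | hx
    · simp [sign_neg hx]
    · simp
    · simp [sign_pos hx]
  set sg : V → ℝ := fun e => (SignType.sign (δ e) : ℝ) with hsg
  -- The tent joins the signs at the two cuts bounding the arc. The damping factor enforces the
  -- noise margin and equals 1 at positions `0` and `m`, where `stepSq` vanishes.
  set Q : V → ℕ → ℝ := fun s k => tent (arcSize T S s) (sg (arcTail T S s)) (sg s) k
    * (1 - θ * √(stepSq (arcSize T S s) k)) with hQ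
  set q : V → ℝ := fun e => Q (arcHead T S e) (arcPos T S e) with hq
  have hqS : ∀ e ∈ S, q e = sg e := by
    intro e he
    simp [hq, hQ, arcHead_of_mem he, arcPos_of_mem he, tent_zero, stepSq]
  -- The profile at position `m` is the sign at the preceding cut, so increments across an arc
  -- boundary obey the same formula as those inside.
  have hpred : ∀ v, q (T.symm v) = Q (arcHead T S v) (arcPos T S v + 1) := by
    intro v
    by_cases hv : T.symm v ∈ S
    · rw [hqS _ hv, arcPos_add_one_of_symm_mem hr hv]
      simp only [hQ, tent_self (hsize _ (arcHead_mem hr v)), ← symm_eq_arcTail hr hv]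
      simp [stepSq]
    · simp only [hq, arcPos_symm_of_notMem hr hv, arcHead_symm_of_notMem hr hv]
  have hdiff : ∀ v, |q (T.symm v) - q v| ≤ tentSlope (M v) (arcPos T S v)
      + θ * |√(stepSq (M v) (arcPos T S v + 1)) - √(stepSq (M v) (arcPos T S v))| := by
    intro v
    rw [hpred]
    have hs := arcHead_mem hr v
    refine (abs_mul_one_sub_sub_le hθ (abs_tent_le_one (hsize _ hs)
      (arcPos_lt_arcSize hr v).le (hsgn _) (hsgn _)) (by positivity) (hω _ hs _)).trans ?_
    gcongr
    exact abs_tent_succ_sub_le (hsize _ hs) (hsgn _) (hsgn _)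
  have hle : ∑ e ∈ S, |δ e| - ∑ e ∈ Sᶜ, (1 - θ * √(stepSq (M e) (arcPos T S e))) * |δ e|
      ≤ ∑ e, q e * δ e := by
    rw [← Finset.sum_add_sum_compl S, sub_eq_add_neg, ← Finset.sum_neg_distrib]
    refine add_le_add (Finset.sum_le_sum fun e he => ?_) (Finset.sum_le_sum fun e he => ?_)
    · rw [hqS e he, hsg, sign_mul_self]
    · have h1 : |q e| ≤ 1 - θ * √(stepSq (M e) (arcPos T S e)) := by
        have hs := arcHead_mem hr e
        simp only [hq, hQ, abs_mul]
        rw [abs_of_nonneg (a := 1 - θ * √(stepSq _ (arcPos T S e)))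
          (by linarith [hω _ hs (arcPos T S e)])]
        exact mul_le_of_le_one_left (by linarith [hω _ hs (arcPos T S e)])
          (abs_tent_le_one (hsize _ hs) (arcPos_lt_arcSize hr e).le (hsgn _) (hsgn _))
      have h2 : -(q e * δ e) ≤ |q e| * |δ e| := by rw [← abs_mul]; exact neg_le_abs _
      have h3 := mul_le_mul_of_nonneg_right h1 (abs_nonneg (δ e))
      linarith
  refine hle.trans ?_
  rw [← sum_mul_symm_sub (T := T) h q]
  calc ∑ v, h v * (q (T.symm v) - q v)
      ≤ ∑ v, (tentSlope (M v) (arcPos T S v) * |h v| + θ *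
        (|√(stepSq (M v) (arcPos T S v + 1)) - √(stepSq (M v) (arcPos T S v))| * |h v|)) := by
        refine Finset.sum_le_sum fun v _ => ?_
        refine (le_abs_self _).trans ?_
        rw [abs_mul, mul_comm]
        refine (mul_le_mul_of_nonneg_right (hdiff v) (abs_nonneg _)).trans (le_of_eq ?_)
        ring
    _ ≤ _ := by
        rw [Finset.sum_add_distrib, ← Finset.mul_sum, add_mul, mul_assoc]
        have hh : √(∑ v, |h v| ^ 2) = √(∑ v, h v ^ 2) := by simp
        refine add_le_add ?_ (mul_le_mul_of_nonneg_left ?_ hθ)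
        · refine (Real.sum_mul_le_sqrt_mul_sqrt _ _ _).trans ?_
          rw [hh]
          refine mul_le_mul_of_nonneg_right (Real.sqrt_le_sqrt (le_of_eq ?_)) (Real.sqrt_nonneg _)
          rw [sum_arcHead_arcPos hr (fun s k => tentSlope (arcSize T S s) k ^ 2)]
          exact Finset.sum_congr rfl fun s hs => sum_tentSlope_sq (hsize s hs)
        · refine (Real.sum_mul_le_sqrt_mul_sqrt _ _ _).trans ?_
          rw [hh]
          refine mul_le_mul_of_nonneg_right (Real.sqrt_le_sqrt ?_) (Real.sqrt_nonneg _)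
          simp only [sq_abs]
          rw [sum_arcHead_arcPos hr (fun s k =>
            (√(stepSq (arcSize T S s) (k + 1)) - √(stepSq (arcSize T S s) k)) ^ 2)]
          exact Finset.sum_le_sum fun s hs => sum_sq_sqrt_stepSq_succ_sub (hsize s hs)

/-- Jensen's inequality, through the tangent of the logarithm at the mean arc size. -/
lemma sum_log_arcSize_le (hr : ∀ v, ∃ k : ℕ, (T ^ k) v ∈ S) (hS : S.Nonempty)
    (hsize : ∀ s ∈ S, 0 < arcSize T S s) :
    ∑ s ∈ S, Real.log (arcSize T S s) ≤ S.card * Real.log (Fintype.card V / S.card) := by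
  have hr0 : (0 : ℝ) < S.card := by exact_mod_cast hS.card_pos
  have hn0 : (0 : ℝ) < Fintype.card V := by
    obtain ⟨s, _⟩ := hS
    exact_mod_cast Fintype.card_pos_iff.2 ⟨s⟩
  have h1 : ∀ s ∈ S, Real.log (arcSize T S s) ≤ Real.log (Fintype.card V / S.card)
      + (arcSize T S s * (S.card / Fintype.card V) - 1) := by
    intro s hs
    have hm : (0 : ℝ) < arcSize T S s := by exact_mod_cast hsize s hs
    have h2 := Real.log_le_sub_one_of_pos
      (show 0 < (arcSize T S s : ℝ) * (S.card / Fintype.card V) by positivity)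
    rw [Real.log_mul hm.ne' (by positivity), ← inv_div (Fintype.card V : ℝ) (S.card : ℝ),
      Real.log_inv, inv_div] at h2
    linarith
  refine (Finset.sum_le_sum h1).trans (le_of_eq ?_)
  rw [Finset.sum_add_distrib, Finset.sum_sub_distrib, ← Finset.sum_mul, sum_arcSize hr]
  simp only [Finset.sum_const, nsmul_eq_mul]
  field_simp
  ring

end Compatibility


/-! ### The cycle graph: components are arcs -/

section Cycle

variable {n : ℕ}

lemma finRotate_ne_self (hn : 2 ≤ n) (v : Fin n) : finRotate n v ≠ v := by
  have : v ∈ (finRotate n).support := by rw [support_finRotate_of_le hn]; simp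
  exact Equiv.Perm.mem_support.1 this

lemma exists_pow_finRotate_mem (hn : 2 ≤ n) {S : Finset (Fin n)} (hS : S.Nonempty) (v : Fin n) :
    ∃ k : ℕ, (finRotate n ^ k) v ∈ S := by
  obtain ⟨s, hs⟩ := hS
  obtain ⟨k, hk⟩ := (isCycle_finRotate_of_le hn).exists_pow_eq (finRotate_ne_self hn v)
    (finRotate_ne_self hn s)
  exact ⟨k, by rwa [hk]⟩

lemma cycleD_mulVec (hn : 2 ≤ n) (g : Fin n → ℝ) (j : Fin n) :
    (cycleD n).mulVec g j = g (finRotate n j) - g j := by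
  have hne := finRotate_ne_self hn j
  have h1 : ∀ v, cycleD n j v * g v
      = (if v = finRotate n j then g v else 0) - (if v = j then g v else 0) := by
    intro v
    simp only [cycleD, incidence, Matrix.of_apply]
    by_cases hv : v = j
    · have : v ≠ finRotate n j := fun h => hne (h.symm.trans hv)
      rw [if_pos hv, if_neg this, if_pos hv]; ring
    · rw [if_neg hv, if_neg hv]
      split_ifs <;> ring
  rw [Matrix.mulVec, dotProduct]
  simp only [h1, Finset.sum_sub_distrib, Finset.sum_ite_eq', Finset.mem_univ, if_true]

lemma cycleMinus_adj_finRotate (hn : 2 ≤ n) {S : Finset (Fin n)} {v : Fin n} (hv : v ∉ S) :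
    (cycleMinus S).Adj v (finRotate n v) := by
  rw [cycleMinus, removeEdges, SimpleGraph.fromRel_adj]
  exact ⟨(finRotate_ne_self hn v).symm, Or.inl ⟨v, hv, rfl, rfl⟩⟩

lemma arcHead_eq_of_adj (hn : 2 ≤ n) {S : Finset (Fin n)} (hS : S.Nonempty) {v w : Fin n}
    (h : (cycleMinus S).Adj v w) : arcHead (finRotate n) S v = arcHead (finRotate n) S w := by
  rw [cycleMinus, removeEdges, SimpleGraph.fromRel_adj] at h
  obtain ⟨_, ⟨e, he, rfl, rfl⟩ | ⟨e, he, rfl, rfl⟩⟩ := h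
  · exact arcHead_of_notMem (exists_pow_finRotate_mem hn hS) he
  · exact (arcHead_of_notMem (exists_pow_finRotate_mem hn hS) he).symm

lemma reachable_arcHead (hn : 2 ≤ n) {S : Finset (Fin n)} (hS : S.Nonempty) (v : Fin n) :
    (cycleMinus S).Reachable v (arcHead (finRotate n) S v) := by
  have hr := exists_pow_finRotate_mem hn hS
  generalize hk : arcPos (finRotate n) S v = k
  induction k generalizing v with
  | zero => rw [arcHead_of_mem (mem_of_arcPos_eq_zero hr hk)]
  | succ k ih =>
    have hv : v ∉ S := fun h => by rw [arcPos_of_mem h] at hk; omega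
    have h1 := arcPos_of_notMem hr hv
    rw [arcHead_of_notMem hr hv]
    exact (cycleMinus_adj_finRotate hn hv).reachable.trans (ih _ (by omega))

lemma reachable_iff_arcHead_eq (hn : 2 ≤ n) {S : Finset (Fin n)} (hS : S.Nonempty)
    {v w : Fin n} : (cycleMinus S).Reachable v w ↔
      arcHead (finRotate n) S v = arcHead (finRotate n) S w := by
  constructor
  · rintro ⟨p⟩
    induction p with
    | nil => rfl
    | cons h _ ih => exact (arcHead_eq_of_adj hn hS h).trans ih
  · intro h
    have := reachable_arcHead hn hS w
    rw [← h] at this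
    exact (reachable_arcHead hn hS v).trans this.symm

lemma compSize_mk (hn : 2 ≤ n) {S : Finset (Fin n)} (hS : S.Nonempty) {s : Fin n} (hs : s ∈ S) :
    compSize S ((cycleMinus S).connectedComponentMk s) = arcSize (finRotate n) S s := by
  rw [compSize, arcSize, ← Set.ncard_coe_finset]
  congr 1
  ext v
  simp only [SimpleGraph.ConnectedComponent.mem_supp_iff, SimpleGraph.ConnectedComponent.eq,
    reachable_iff_arcHead_eq hn hS, arcHead_of_mem hs, Finset.coe_filter, Finset.mem_univ,
    true_and, Set.mem_ofPred_eq]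

/-- The map from `S` to the connected components that sends an edge to the component in which it
starts. -/
def componentOf (S : Finset (Fin n)) (s : S) : (cycleMinus S).ConnectedComponent :=
  (cycleMinus S).connectedComponentMk s

lemma componentOf_bijective (hn : 2 ≤ n) {S : Finset (Fin n)} (hS : S.Nonempty) :
    Function.Bijective (componentOf S) := by
  constructor
  · rintro ⟨s, hs⟩ ⟨t, ht⟩ h
    rw [componentOf, componentOf, SimpleGraph.ConnectedComponent.eq,
      reachable_iff_arcHead_eq hn hS] at h
    simpa [arcHead_of_mem hs, arcHead_of_mem ht] using h
  · intro C
    induction C using SimpleGraph.ConnectedComponent.ind with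
    | h v =>
      refine ⟨⟨arcHead (finRotate n) S v, arcHead_mem (exists_pow_finRotate_mem hn hS) v⟩, ?_⟩
      exact SimpleGraph.ConnectedComponent.eq.2 (reachable_arcHead hn hS v).symm

lemma kPrime_eq_sum (hn : 2 ≤ n) {S : Finset (Fin n)} (hS : S.Nonempty) :
    kPrime S = ∑ s ∈ S, (1 / ((arcSize (finRotate n) S s / 2 : ℕ) : ℝ)
      + 1 / (((arcSize (finRotate n) S s + 1) / 2 : ℕ) : ℝ)) := by
  rw [kPrime, ← finsum_comp _ (componentOf_bijective hn hS), finsum_eq_sum_of_fintype,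
    ← Finset.sum_coe_sort S]
  refine Finset.sum_congr rfl fun s _ => ?_
  rw [componentOf, compSize_mk hn hS s.2]

lemma nMin_le_arcSize (hn : 2 ≤ n) {S : Finset (Fin n)} (hS : S.Nonempty) {s : Fin n}
    (hs : s ∈ S) : nMin S ≤ arcSize (finRotate n) S s := by
  rw [← compSize_mk hn hS hs]
  exact ciInf_le (OrderBot.bddBelow _) _

lemma arcSize_le_nMax (hn : 2 ≤ n) {S : Finset (Fin n)} (hS : S.Nonempty) {s : Fin n}
    (hs : s ∈ S) : arcSize (finRotate n) S s ≤ nMax S := by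
  rw [← compSize_mk hn hS hs]
  exact le_ciSup (f := fun C => compSize S C) (Set.finite_range _).bddAbove _

/-- The null space consists of the arcwise constant functions, and restriction to `S` identifies it
with the functions on `S`. -/
lemma rDim_cycleD (hn : 2 ≤ n) {S : Finset (Fin n)} (hS : S.Nonempty) :
    rDim (cycleD n) S = S.card := by
  have hr := exists_pow_finRotate_mem hn hS
  have hker : ∀ g : Fin n → ℝ, g ∈ LinearMap.ker (rowsOff (cycleD n) S).mulVecLin ↔
      ∀ v ∉ S, g (finRotate n v) = g v := by
    intro g
    rw [LinearMap.mem_ker]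
    constructor
    · intro h v hv
      have := congrFun h ⟨v, hv⟩
      have h2 : (cycleD n).mulVec g v = 0 := this
      rw [cycleD_mulVec hn] at h2
      linarith
    · intro h
      ext ⟨v, hv⟩
      have h2 : (cycleD n).mulVec g v = 0 := by rw [cycleD_mulVec hn, h v hv, sub_self]
      exact h2
  have hconst : ∀ g : Fin n → ℝ, (∀ v ∉ S, g (finRotate n v) = g v) →
      ∀ v, g v = g (arcHead (finRotate n) S v) := by
    intro g hg v
    generalize hk : arcPos (finRotate n) S v = k
    induction k generalizing v with
    | zero => rw [arcHead_of_mem (mem_of_arcPos_eq_zero hr hk)]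
    | succ k ih =>
      have hv : v ∉ S := fun h => by rw [arcPos_of_mem h] at hk; omega
      have h1 := arcPos_of_notMem hr hv
      rw [arcHead_of_notMem hr hv, ← hg v hv]
      exact ih _ (by omega)
  let φ : LinearMap.ker (rowsOff (cycleD n) S).mulVecLin →ₗ[ℝ] (S → ℝ) :=
    (LinearMap.funLeft ℝ ℝ (Subtype.val : S → Fin n)).comp (Submodule.subtype _)
  have hφ : Function.Bijective φ := by
    constructor
    · rintro ⟨g, hg⟩ ⟨g', hg'⟩ h
      ext v
      rw [hker] at hg hg'
      have := congrFun h ⟨arcHead (finRotate n) S v, arcHead_mem hr v⟩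
      have h2 : g (arcHead (finRotate n) S v) = g' (arcHead (finRotate n) S v) := this
      change g v = g' v
      rw [hconst g hg, hconst g' hg', h2]
    · intro x
      refine ⟨⟨fun v => x ⟨arcHead (finRotate n) S v, arcHead_mem hr v⟩, ?_⟩, ?_⟩
      · rw [hker]
        intro v hv
        simp only [← arcHead_of_notMem hr hv]
      · ext ⟨s, hs⟩
        change x ⟨arcHead (finRotate n) S s, _⟩ = x ⟨s, hs⟩
        simp only [arcHead_of_mem hs]
  rw [rDim, (LinearEquiv.ofBijective φ hφ).finrank_eq, Module.finrank_fintype_fun_eq_card,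
    Fintype.card_coe]

end Cycle

/-! ### Minimizers of a norm plus a convex penalty -/

section SquareRootLoss

variable {E : Type*} [NormedAddCommGroup E] [InnerProductSpace ℝ E] {Φ : E → ℝ}

/-- The first order optimality condition for a minimizer of the square root loss with a convex
penalty. -/
lemma inner_residual_le (hΦ : ConvexOn ℝ Set.univ Φ) {y g₀ : E}
    (hmin : ∀ g, ‖y - g₀‖ + Φ g₀ ≤ ‖y - g‖ + Φ g) (hne : 0 < ‖y - g₀‖) (g : E) :
    inner ℝ (y - g₀) (g - g₀) ≤ ‖y - g₀‖ * (Φ g - Φ g₀) := by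
  set R := ‖y - g₀‖ with hR
  set I := inner ℝ (y - g₀) (g - g₀) with hI
  by_contra! hlt
  set N := ‖g - g₀‖ ^ 2 with hN
  have hN0 : 0 ≤ N := sq_nonneg _
  -- Minimality is tested on the segment from `g₀` to `g`, and `2RR' ≤ R² + R'²` replaces
  -- differentiation of the norm. A small `t` then contradicts a positive left side.
  have key : ∀ t : ℝ, 0 < t → t ≤ 1 → 2 * (I - R * (Φ g - Φ g₀)) ≤ t * N := by
    intro t ht0 ht1
    have h1 := hmin (g₀ + t • (g - g₀))
    have h2 : Φ (g₀ + t • (g - g₀)) ≤ (1 - t) * Φ g₀ + t * Φ g := by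
      have := hΦ.2 (Set.mem_univ g₀) (Set.mem_univ g) (show 0 ≤ 1 - t by linarith) ht0.le (by ring)
      rw [show g₀ + t • (g - g₀) = (1 - t) • g₀ + t • g by module]
      simpa using this
    set R' := ‖y - (g₀ + t • (g - g₀))‖ with hR'
    have h3 : R' ^ 2 = R ^ 2 - 2 * t * I + t ^ 2 * N := by
      rw [hR', show y - (g₀ + t • (g - g₀)) = (y - g₀) - t • (g - g₀) by abel,
        norm_sub_sq_real, inner_smul_right, norm_smul, mul_pow, Real.norm_eq_abs, sq_abs]
      ring
    have h4 : R - t * (Φ g - Φ g₀) ≤ R' := by linarith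
    have h5 : 2 * R * R' ≤ R ^ 2 + R' ^ 2 := two_mul_le_add_sq R R'
    have h6 : 2 * R * (R - t * (Φ g - Φ g₀)) ≤ 2 * R * R' := by gcongr
    have h7 : t * (2 * (I - R * (Φ g - Φ g₀))) ≤ t * (t * N) := by nlinarith
    exact le_of_mul_le_mul_left h7 ht0
  set d := 2 * (I - R * (Φ g - Φ g₀)) with hd
  have hd0 : 0 < d := by linarith
  have h1 := key (d / (N + 1 + d)) (by positivity) ((div_le_one (by positivity)).2 (by linarith))
  rw [div_mul_eq_mul_div, le_div_iff₀ (by positivity)] at h1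
  nlinarith

/-- The contradiction between the basic inequality and the size of the signal. -/
lemma false_of_quadratic_bounds {N η ρ A b : ℝ} (hN : 0 < N) (hη0 : 0 < η)
    (hρ0 : 0 ≤ ρ) (hρη : 2 * ρ < η) (hA0 : 0 ≤ A) (hbA : -b ≤ A)
    (h1 : (η * N) ^ 2 ≤ 2 * (ρ * η * N ^ 2) + 4 * ((1 - η) * N * A) - 2 * (η * N * b) + b ^ 2)
    (hbN : b ≤ η * N)
    (hsignal : (A + 2 * N) ^ 2 ≤ ((η / 2 - ρ) ^ 2 + 4) * N ^ 2) : False := by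
  have hηNA : 0 ≤ η * N * A := by positivity
  have h2 : (η * N) ^ 2 ≤ 2 * (ρ * η * N ^ 2) + 4 * (N * A) + A ^ 2 := by
    rcases le_total 0 b with hb0 | hb0
    · have e1 : b * b ≤ η * N * b := mul_le_mul_of_nonneg_right hbN hb0
      have e2 : 0 ≤ η * N * b := by positivity
      linarith [sq_nonneg A]
    · have e1 : b ^ 2 ≤ A ^ 2 := sq_le_sq' (by linarith) (by linarith)
      have e2 := mul_le_mul_of_nonneg_left hbA (show 0 ≤ η * N by positivity)
      linarith
  -- The coefficient on the right is `ρη + ρ² + η²/4`, which is below `η²` because `ρ < η/2`.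
  have h3 : η ^ 2 * N ^ 2 ≤ (2 * (ρ * η) + (η / 2 - ρ) ^ 2) * N ^ 2 := by linarith
  have h4 := le_of_mul_le_mul_right h3 (by positivity)
  nlinarith only [h4, hρη, hρ0, hη0]

/-- A minimizer of the square root loss does not overfit when the penalty dominates the noise. -/
lemma norm_minimizer_sub_le (hΦ : ConvexOn ℝ Set.univ Φ) (hΦ0 : ∀ g, 0 ≤ Φ g)
    {f₀ e g₀ : E} (hmin : ∀ g, ‖f₀ + e - g₀‖ + Φ g₀ ≤ ‖f₀ + e - g‖ + Φ g) (he : 0 < ‖e‖)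
    {η ρ : ℝ} (hη0 : 0 < η) (hη1 : η < 1) (hρ0 : 0 ≤ ρ) (hρη : 2 * ρ < η)
    (hnoise : ∀ h, inner ℝ e h ≤ ρ * ‖e‖ * ‖h‖ + (1 - η) * ‖e‖ * (Φ f₀ + Φ (f₀ + h)))
    (hsignal : (Φ f₀ + 2 * ‖e‖) ^ 2 ≤ ((η / 2 - ρ) ^ 2 + 4) * ‖e‖ ^ 2) :
    ‖g₀ - f₀‖ ≤ η * ‖e‖ := by
  by_contra! hlt
  set N := ‖e‖ with hN
  set h := g₀ - f₀ with hh
  have hh0 : 0 < ‖h‖ := lt_trans (by positivity) hlt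
  -- The error is shrunk to norm exactly `η ‖e‖`. By convexity the objective at the shrunk point is
  -- still at most its value at `f₀`.
  set τ := η * N / ‖h‖ with hτ
  have hτ0 : 0 < τ := by positivity
  have hτ1 : τ ≤ 1 := (div_le_one hh0).2 hlt.le
  set A := Φ f₀ with hA
  set B := Φ (f₀ + τ • h) with hB
  have hA0 : 0 ≤ A := hΦ0 _
  have hB0 : 0 ≤ B := hΦ0 _
  have hnorm : ‖τ • h‖ = η * N := by
    rw [norm_smul, Real.norm_of_nonneg hτ0.le, hτ]; field_simp
  have hBle : B ≤ (1 - τ) * A + τ * Φ g₀ := by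
    have := hΦ.2 (Set.mem_univ f₀) (Set.mem_univ g₀) (show 0 ≤ 1 - τ by linarith) hτ0.le (by ring)
    rw [hB, show f₀ + τ • h = (1 - τ) • f₀ + τ • g₀ by rw [hh]; module]
    simpa using this
  set R := ‖e - τ • h‖ with hR
  have hRle : R ≤ (1 - τ) * N + τ * ‖e - h‖ := by
    rw [hR, show e - τ • h = (1 - τ) • e + τ • (e - h) by module]
    refine (norm_add_le _ _).trans (le_of_eq ?_)
    rw [norm_smul, norm_smul, Real.norm_of_nonneg hτ0.le, Real.norm_of_nonneg (by linarith)]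
  have hobj : ‖e - h‖ + Φ g₀ ≤ N + A := by
    have := hmin f₀
    rwa [show f₀ + e - g₀ = e - h by rw [hh]; abel, add_sub_cancel_left] at this
  have hRAB : R ≤ N + A - B := by nlinarith
  have hRge : N - η * N ≤ R := by
    have := norm_sub_norm_le e (τ • h)
    rwa [hnorm] at this
  have hRsq : R ^ 2 = N ^ 2 - 2 * inner ℝ e (τ • h) + (η * N) ^ 2 := by
    rw [hR, norm_sub_sq_real, hnorm]
  have hI := hnoise (τ • h)
  rw [hnorm] at hI
  have hR0 : 0 ≤ R := norm_nonneg _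
  have hsq : R ^ 2 ≤ (N + A - B) ^ 2 := pow_le_pow_left₀ hR0 hRAB 2
  obtain ⟨b, hb⟩ : ∃ b, B = A + b := ⟨B - A, by ring⟩
  rw [← hB, hb] at hI
  rw [hb] at hsq hRAB
  exact false_of_quadratic_bounds he hη0 hρ0 hρη hA0 (by linarith)
    (by nlinarith only [hI, hsq, hRsq]) (by linarith) hsignal

/-- Polarization of the first order condition leaves a term `-‖g₀ - f‖²`, which absorbs `2B ‖g₀ -
f‖` at the price of `B²`. -/
lemma norm_minimizer_sub_sq_le (hΦ : ConvexOn ℝ Set.univ Φ) {f₀ e g₀ : E}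
    (hmin : ∀ g, ‖f₀ + e - g₀‖ + Φ g₀ ≤ ‖f₀ + e - g‖ + Φ g) (hne : 0 < ‖f₀ + e - g₀‖)
    {f : E} {W B : ℝ}
    (hW : 2 * inner ℝ e (g₀ - f) + 2 * (‖f₀ + e - g₀‖ * (Φ f - Φ g₀)) ≤ W + 2 * B * ‖g₀ - f‖) :
    ‖g₀ - f₀‖ ^ 2 ≤ ‖f - f₀‖ ^ 2 + W + B ^ 2 := by
  have h1 := inner_residual_le hΦ hmin hne f
  have h2 : ‖f - f₀‖ ^ 2 = ‖g₀ - f₀‖ ^ 2 - 2 * inner ℝ (g₀ - f₀) (g₀ - f) + ‖g₀ - f‖ ^ 2 := by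
    rw [← norm_sub_sq_real, show g₀ - f₀ - (g₀ - f) = f - f₀ by abel]
  have h3 : inner ℝ (f₀ + e - g₀) (f - g₀)
      = inner ℝ (g₀ - f₀) (g₀ - f) - inner ℝ e (g₀ - f) := by
    rw [← inner_sub_left, ← neg_sub g₀ f, inner_neg_right, ← inner_neg_left]
    congr 1
    abel
  nlinarith [sq_nonneg (B - ‖g₀ - f‖)]

end SquareRootLoss


/-! ### The deterministic oracle inequality -/

section OracleInequality

variable {V : Type*} [Fintype V]

/-- The total variation of `g` along the permutation `T`. -/
def totalVar (T : Equiv.Perm V) (g : EuclideanSpace ℝ V) : ℝ := ∑ e, |g (T e) - g e|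

lemma totalVar_nonneg (T : Equiv.Perm V) (g : EuclideanSpace ℝ V) : 0 ≤ totalVar T g :=
  Finset.sum_nonneg fun _ _ => abs_nonneg _

lemma convexOn_totalVar (T : Equiv.Perm V) : ConvexOn ℝ Set.univ (totalVar T) := by
  refine ⟨convex_univ, fun g _ h _ a b ha hb _ => ?_⟩
  simp only [totalVar, smul_eq_mul, Finset.mul_sum, ← Finset.sum_add_distrib]
  refine Finset.sum_le_sum fun e _ => ?_
  have : (a • g + b • h) (T e) - (a • g + b • h) e = a * (g (T e) - g e) + b * (h (T e) - h e) := by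
    simp only [PiLp.add_apply, PiLp.smul_apply, smul_eq_mul]; ring
  rw [this]
  refine (abs_add_le _ _).trans ?_
  rw [abs_mul, abs_mul, abs_of_nonneg ha, abs_of_nonneg hb]

lemma totalVar_sub_le (T : Equiv.Perm V) (g h : EuclideanSpace ℝ V) :
    totalVar T (g - h) ≤ totalVar T g + totalVar T h := by
  simp only [totalVar, ← Finset.sum_add_distrib]
  refine Finset.sum_le_sum fun e _ => ?_
  have : (g - h) (T e) - (g - h) e = (g (T e) - g e) - (h (T e) - h e) := by
    simp only [PiLp.sub_apply]; ring
  rw [this]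
  exact abs_sub _ _

lemma norm_eq_sqrt_sum_sq (g : EuclideanSpace ℝ V) : ‖g‖ = √(∑ v, g v ^ 2) := by
  rw [EuclideanSpace.norm_eq]; simp

lemma norm_residual_le {T : Equiv.Perm V} {Λ : ℝ} (hΛ : 0 < Λ) {f₀ x g₀ : EuclideanSpace ℝ V}
    (hmin : ∀ g, ‖f₀ + x - g₀‖ + Λ * totalVar T g₀ ≤ ‖f₀ + x - g‖ + Λ * totalVar T g) :
    ‖f₀ + x - g₀‖ ≤ ‖x‖ + Λ * totalVar T f₀ := by
  have := hmin f₀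
  rw [add_sub_cancel_left] at this
  have := mul_nonneg hΛ.le (totalVar_nonneg T g₀)
  linarith

variable [DecidableEq V] {T : Equiv.Perm V} {S : Finset V}

/-- The norm of the projection of `x` on the functions that are constant on arcs. -/
noncomputable def arcProjNorm (T : Equiv.Perm V) (S : Finset V) (x : V → ℝ) : ℝ :=
  √(∑ v, arcMean T S x (arcHead T S v) ^ 2)

lemma inner_le_of_noise (hr : ∀ v, ∃ k : ℕ, (T ^ k) v ∈ S) {x : EuclideanSpace ℝ V} {c : ℝ}
    (hnoise : ∀ e ∉ S, |arcStep T S e ⬝ᵥ x| ≤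
      c * √(stepSq (arcSize T S (arcHead T S e)) (arcPos T S e))) (h : EuclideanSpace ℝ V) :
    inner ℝ x h ≤ arcProjNorm T S x * ‖h‖ + ∑ e ∈ Sᶜ,
      c * √(stepSq (arcSize T S (arcHead T S e)) (arcPos T S e)) * |h (T e) - h e| := by
  have h1 : inner ℝ x h = (x : V → ℝ) ⬝ᵥ (h : V → ℝ) := by
    rw [PiLp.inner_apply, dotProduct]
    exact Finset.sum_congr rfl fun _ _ => mul_comm _ _
  rw [h1, dotProduct_eq_arcMean_add_arcStep hr]
  refine add_le_add ?_ (Finset.sum_le_sum fun e he => ?_)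
  · rw [norm_eq_sqrt_sum_sq, arcProjNorm]
    exact Real.sum_mul_le_sqrt_mul_sqrt _ _ _
  · refine (le_abs_self _).trans ?_
    rw [abs_mul, mul_comm]
    exact mul_le_mul_of_nonneg_right (hnoise e (Finset.mem_compl.1 he)) (abs_nonneg _)

/-- The triangle inequality is used in opposite directions on and off `S`, so that the increments of
`g - f` off `S` enter with a favorable sign. -/
lemma totalVar_sub_totalVar_le (f g : EuclideanSpace ℝ V) :
    totalVar T f - totalVar T g ≤
      ∑ e ∈ S, |(g - f) (T e) - (g - f) e| - ∑ e ∈ Sᶜ, |(g - f) (T e) - (g - f) e|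
        + 2 * ∑ e ∈ Sᶜ, |f (T e) - f e| := by
  have hs : ∀ e, (g - f) (T e) - (g - f) e = (g (T e) - g e) - (f (T e) - f e) := by
    intro e; simp only [PiLp.sub_apply]; ring
  have h1 : ∀ e ∈ S, |f (T e) - f e| - |g (T e) - g e| ≤ |(g - f) (T e) - (g - f) e| := by
    intro e _
    rw [hs, abs_sub_comm (g (T e) - g e)]
    exact abs_sub_abs_le_abs_sub _ _
  have h2 : ∀ e ∈ Sᶜ, |f (T e) - f e| - |g (T e) - g e| ≤
      2 * |f (T e) - f e| - |(g - f) (T e) - (g - f) e| := by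
    intro e _
    rw [hs]
    linarith [abs_sub (g (T e) - g e) (f (T e) - f e)]
  have h3 := Finset.sum_le_sum h1
  have h4 := Finset.sum_le_sum h2
  simp only [Finset.sum_sub_distrib, ← Finset.mul_sum] at h3 h4
  rw [totalVar, totalVar, ← Finset.sum_add_sum_compl S, ← Finset.sum_add_sum_compl S]
  linarith

/-- The oracle inequality for a fixed noise vector `x`. -/
theorem oracle_inequality_of_noise (hr : ∀ v, ∃ k : ℕ, (T ^ k) v ∈ S)
    (hsize : ∀ s ∈ S, 2 ≤ arcSize T S s) {Λ s η ρ : ℝ} (hΛ : 0 < Λ) (hs : 0 ≤ s)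
    (hη0 : 0 < η) (hη1 : η < 1) (hρ0 : 0 ≤ ρ) (hρη : 2 * ρ < η)
    (hdom : ∀ i ∈ S, s * √(arcSize T S i : ℝ) ≤ 2 * (Λ * (1 - η)))
    {f₀ x g₀ : EuclideanSpace ℝ V} (hx : 0 < ‖x‖)
    (hmin : ∀ g, ‖f₀ + x - g₀‖ + Λ * totalVar T g₀ ≤ ‖f₀ + x - g‖ + Λ * totalVar T g)
    (hnoise : ∀ e ∉ S, |arcStep T S e ⬝ᵥ x| ≤
      s * ‖x‖ * √(stepSq (arcSize T S (arcHead T S e)) (arcPos T S e)))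
    (hproj : arcProjNorm T S x ≤ ρ * ‖x‖)
    (hsignal : (Λ * totalVar T f₀ + 2 * ‖x‖) ^ 2 ≤ ((η / 2 - ρ) ^ 2 + 4) * ‖x‖ ^ 2)
    (f : EuclideanSpace ℝ V) :
    ‖g₀ - f₀‖ ^ 2 ≤ ‖f - f₀‖ ^ 2
      + 4 * (Λ * ‖f₀ + x - g₀‖) * ∑ e ∈ Sᶜ, |f (T e) - f e|
      + (arcProjNorm T S x + Λ * ‖f₀ + x - g₀‖ *
        (√(∑ i ∈ S, (1 / ((arcSize T S i / 2 : ℕ) : ℝ) + 1 / (((arcSize T S i + 1) / 2 : ℕ) : ℝ)))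
          + s / (Λ * (1 - η)) * √(∑ i ∈ S, 5 * Real.log (arcSize T S i)))) ^ 2 := by
  have h1η : 0 < 1 - η := by linarith
  have hΛη : 0 < Λ * (1 - η) := by positivity
  set θ := s / (Λ * (1 - η)) with hθ
  have hθ0 : 0 ≤ θ := by positivity
  have hsθ : s = θ * (Λ * (1 - η)) := by rw [hθ]; field_simp
  have hθ1 : ∀ i ∈ S, θ * √(arcSize T S i : ℝ) ≤ 2 := by
    intro i hi
    rw [hθ, div_mul_eq_mul_div, div_le_iff₀ hΛη]
    exact hdom i hi
  set w : V → ℝ := fun e => √(stepSq (arcSize T S (arcHead T S e)) (arcPos T S e)) with hw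
  have hw0 : ∀ e, 0 ≤ w e := fun e => Real.sqrt_nonneg _
  have hω : ∀ e, θ * w e ≤ 1 := by
    intro e
    have h1 : w e ≤ √(arcSize T S (arcHead T S e) : ℝ) / 2 := by
      rw [show √(arcSize T S (arcHead T S e) : ℝ) / 2
          = √((arcSize T S (arcHead T S e) : ℝ) / 4) by
        rw [Real.sqrt_div' _ (by norm_num), show (4 : ℝ) = 2 ^ 2 by norm_num,
          Real.sqrt_sq (by norm_num)]]
      exact Real.sqrt_le_sqrt (stepSq_le _ _)
    have h2 := hθ1 _ (arcHead_mem hr e)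
    have h3 := mul_le_mul_of_nonneg_left h1 hθ0
    linarith
  have hΦ : ConvexOn ℝ Set.univ fun g => Λ * totalVar T g := (convexOn_totalVar T).smul hΛ.le
  have hinner := inner_le_of_noise hr hnoise
  have hclose : ‖g₀ - f₀‖ ≤ η * ‖x‖ := by
    refine norm_minimizer_sub_le hΦ (fun g => mul_nonneg hΛ.le (totalVar_nonneg T g)) hmin hx
      hη0 hη1 hρ0 hρη (fun h => (hinner h).trans (add_le_add ?_ ?_)) hsignal
    · exact mul_le_mul_of_nonneg_right hproj (norm_nonneg _)
    · have h1 : totalVar T h ≤ totalVar T f₀ + totalVar T (f₀ + h) := by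
        have := totalVar_sub_le T (f₀ + h) f₀
        rw [add_sub_cancel_left] at this
        linarith
      calc ∑ e ∈ Sᶜ, s * ‖x‖ * w e * |h (T e) - h e|
          ≤ ∑ e ∈ Sᶜ, Λ * (1 - η) * ‖x‖ * |h (T e) - h e| := by
            refine Finset.sum_le_sum fun e _ => mul_le_mul_of_nonneg_right ?_ (abs_nonneg _)
            rw [hsθ]
            have := mul_le_mul_of_nonneg_left (hω e)
              (show 0 ≤ Λ * (1 - η) * ‖x‖ by positivity)
            linarith
        _ ≤ ∑ e, Λ * (1 - η) * ‖x‖ * |h (T e) - h e| :=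
            Finset.sum_le_sum_of_subset_of_nonneg (Finset.subset_univ _)
              fun e _ _ => by positivity
        _ = Λ * (1 - η) * ‖x‖ * totalVar T h := by rw [← Finset.mul_sum, totalVar]
        _ ≤ Λ * (1 - η) * ‖x‖ * (totalVar T f₀ + totalVar T (f₀ + h)) :=
            mul_le_mul_of_nonneg_left h1 (by positivity)
        _ = _ := by ring
  set R := ‖f₀ + x - g₀‖ with hR
  have hRx : (1 - η) * ‖x‖ ≤ R := by
    have := norm_sub_norm_le x (g₀ - f₀)
    rw [show x - (g₀ - f₀) = f₀ + x - g₀ by abel] at this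
    linarith
  have hR0 : 0 < R := lt_of_lt_of_le (by positivity) hRx
  refine norm_minimizer_sub_sq_le hΦ hmin hR0 ?_
  have hcomp := compatibility_arc hr hsize hθ0 hθ1 (fun v => (g₀ - f) v)
  rw [← norm_eq_sqrt_sum_sq] at hcomp
  have htv := totalVar_sub_totalVar_le (T := T) (S := S) f g₀
  have hin := hinner (g₀ - f)
  -- Since `s = θ Λ (1 - η)` and `(1 - η) ‖x‖ ≤ R`, the noise level `s ‖x‖` is at most `θ Λ R`: the
  -- residual replaces the unknown noise norm.
  have hns : ∑ e ∈ Sᶜ, s * ‖x‖ * w e * |(g₀ - f) (T e) - (g₀ - f) e|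
      ≤ Λ * R * ∑ e ∈ Sᶜ, θ * w e * |(g₀ - f) (T e) - (g₀ - f) e| := by
    rw [Finset.mul_sum]
    refine Finset.sum_le_sum fun e _ => ?_
    rw [← mul_assoc]
    refine mul_le_mul_of_nonneg_right ?_ (abs_nonneg _)
    rw [hsθ]
    have := mul_le_mul_of_nonneg_left hRx (show 0 ≤ Λ * (θ * w e) by have := hw0 e; positivity)
    linarith
  simp only [sub_mul, one_mul, Finset.sum_sub_distrib] at hcomp
  have hΛR : 0 ≤ Λ * R := by positivity
  have e1 := mul_le_mul_of_nonneg_left hcomp hΛR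
  have e2 := mul_le_mul_of_nonneg_left htv hΛR
  simp only [hw] at hns hin
  linarith

end OracleInequality


/-! ### Probability of the good noise event -/

section Noise

variable {n : ℕ} {T : Equiv.Perm (Fin n)} {S : Finset (Fin n)}

/-- The event on which a standard Gaussian vector satisfies all bounds that the oracle inequality
needs. -/
structure GoodNoise (T : Equiv.Perm (Fin n)) (S : Finset (Fin n)) (a s : ℝ) (z : Fin n → ℝ) :
    Prop where
  lower : (n : ℝ) - √(8 * a * n) < ∑ i, z i ^ 2
  upper : ∑ i, z i ^ 2 < 9 * n
  proj : arcProjNorm T S z < √(S.card : ℝ) + √(2 * a)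
  noise : ∀ e ∉ S, |arcStep T S e ⬝ᵥ z| ≤
    s * √(∑ i, z i ^ 2) * √(stepSq (arcSize T S (arcHead T S e)) (arcPos T S e))

/-- The normalized indicator of the arc that ends in `i`. -/
noncomputable def arcUnit (T : Equiv.Perm (Fin n)) (S : Finset (Fin n)) (i v : Fin n) : ℝ :=
  if arcHead T S v = i then (√(arcSize T S i : ℝ))⁻¹ else 0

lemma arcUnit_dotProduct (i : Fin n) (z : Fin n → ℝ) :
    arcUnit T S i ⬝ᵥ z = √(arcSize T S i : ℝ) * arcMean T S z i := by
  simp only [dotProduct, arcUnit, ite_mul, zero_mul]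
  rw [← Finset.sum_filter, ← Finset.mul_sum, arcMean]
  rcases Nat.eq_zero_or_pos (arcSize T S i) with h | h
  · simp [h]
  · have h0 : (0 : ℝ) < arcSize T S i := by exact_mod_cast h
    have h1 := Real.sqrt_pos.2 h0
    have h2 := Real.sq_sqrt h0.le
    field_simp
    rw [h2, mul_comm]

lemma arcUnit_orthonormal {i j : Fin n} (hi : 0 < arcSize T S i) :
    arcUnit T S i ⬝ᵥ arcUnit T S j = if i = j then 1 else 0 := by
  have h0 : (0 : ℝ) < arcSize T S i := by exact_mod_cast hi
  rw [arcUnit_dotProduct, arcMean]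
  split_ifs with h
  · subst h
    rw [Finset.sum_congr rfl (g := fun _ => (√(arcSize T S i : ℝ))⁻¹)
      (fun v hv => by rw [arcUnit, if_pos (Finset.mem_filter.1 hv).2]),
      Finset.sum_const, ← arcSize, nsmul_eq_mul]
    have h1 := Real.sqrt_pos.2 h0
    field_simp
  · rw [Finset.sum_eq_zero, zero_div, mul_zero]
    intro v hv
    rw [arcUnit, if_neg]
    rw [(Finset.mem_filter.1 hv).2]
    exact h

/-- The normalized arc indicators are orthonormal, so for Gaussian `z` this is a chi-square variable
with `S.card` degrees of freedom. -/
lemma arcProjNorm_sq (hr : ∀ v, ∃ k : ℕ, (T ^ k) v ∈ S) (z : Fin n → ℝ) :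
    arcProjNorm T S z ^ 2 = ∑ i ∈ S, (arcUnit T S i ⬝ᵥ z) ^ 2 := by
  rw [arcProjNorm, Real.sq_sqrt (Finset.sum_nonneg fun _ _ => sq_nonneg _), sum_arcMean_sq hr]
  refine Finset.sum_congr rfl fun i _ => ?_
  rw [arcUnit_dotProduct, mul_pow, Real.sq_sqrt (Nat.cast_nonneg _)]

lemma arcStep_tail (hr : ∀ v, ∃ k : ℕ, (T ^ k) v ∈ S) {e : Fin n} (he : e ∉ S) {s : ℝ}
    (hs : 0 ≤ s) :
    (stdPi (Fin n)).real {z | ¬ |arcStep T S e ⬝ᵥ z| ≤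
      s * √(∑ i, z i ^ 2) * √(stepSq (arcSize T S (arcHead T S e)) (arcPos T S e))} ≤
      2 * Real.exp (-(s ^ 2 * ((n : ℝ) - 1) / 2)) := by
  set q := stepSq (arcSize T S (arcHead T S e)) (arcPos T S e) with hq
  have hlt := arcPos_lt_arcSize hr e
  have hpos : 0 < arcPos T S e :=
    Nat.pos_of_ne_zero fun h => he (mem_of_arcPos_eq_zero hr h)
  have hq0 : 0 < q := by
    have h1 : (0 : ℝ) < arcPos T S e := by exact_mod_cast hpos
    have h2 : (arcPos T S e : ℝ) < arcSize T S (arcHead T S e) := by exact_mod_cast hlt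
    rw [hq, stepSq]
    exact div_pos (mul_pos h1 (by linarith)) (by linarith)
  have hsq : 0 < √q := Real.sqrt_pos.2 hq0
  have hqq := Real.sq_sqrt hq0.le
  have hu : ((√q)⁻¹ • arcStep T S e) ⬝ᵥ ((√q)⁻¹ • arcStep T S e) = 1 := by
    rw [smul_dotProduct, dotProduct_smul]
    have : arcStep T S e ⬝ᵥ arcStep T S e = q := by
      rw [hq, ← sum_arcStep_sq hr, dotProduct]
      exact Finset.sum_congr rfl fun _ _ => (sq _).symm
    rw [this, smul_eq_mul, smul_eq_mul]
    field_simp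
    exact hqq.symm
  refine le_trans (measureReal_mono ?_) (selfNormalized_tail hu (s := s))
  intro z hz
  simp only [Set.mem_ofPred_eq, not_le] at hz ⊢
  have hN := Real.sq_sqrt (Finset.sum_nonneg fun i (_ : i ∈ Finset.univ) => sq_nonneg (z i))
  rw [smul_dotProduct, smul_eq_mul, mul_pow, inv_pow, hqq, ← hN, inv_mul_eq_div, lt_div_iff₀ hq0,
    ← sq_abs (arcStep T S e ⬝ᵥ z), ← mul_pow]
  calc (s * √(∑ i, z i ^ 2)) ^ 2 * q = (s * √(∑ i, z i ^ 2) * √q) ^ 2 := by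
        rw [mul_pow _ (√q), hqq]
    _ < _ := pow_lt_pow_left₀ hz (by positivity) two_ne_zero

lemma goodNoise_compl_le (hr : ∀ v, ∃ k : ℕ, (T ^ k) v ∈ S) (hS : S.Nonempty)
    (hsize : ∀ i ∈ S, 0 < arcSize T S i) {a s t : ℝ} (ha : 0 < a) (han : a ≤ n) (hs : 0 ≤ s)
    (hst : s ^ 2 * ((n : ℝ) - 1) / 2 = Real.log (2 * n) + t) :
    (stdPi (Fin n)).real {z | ¬ GoodNoise T S a s z} ≤ Real.exp (-t) + 3 * Real.exp (-a) := by
  have : Nonempty (Fin n) := ⟨hS.choose⟩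
  have hn : (0 : ℝ) < n := by linarith
  have h1 := chiSq_lower_tail (ι := Fin n) ha
  have h2 := chiSq_large (ι := Fin n)
  rw [Fintype.card_fin] at h1 h2
  have h2' : Real.exp (-(n : ℝ)) ≤ Real.exp (-a) := Real.exp_le_exp.2 (by linarith)
  have h3 := orthonormal_chiSq_upper_tail (u := arcUnit T S) hS
    (fun i hi j _ => arcUnit_orthonormal (hsize i hi)) ha
  -- Union bound over at most `n` steps, each failing with probability at most `2 exp (-t) / (2n)`.
  have h4 : (stdPi (Fin n)).real (⋃ e ∈ Sᶜ, {z | ¬ |arcStep T S e ⬝ᵥ z| ≤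
      s * √(∑ i, z i ^ 2) * √(stepSq (arcSize T S (arcHead T S e)) (arcPos T S e))})
      ≤ Real.exp (-t) := by
    refine (measureReal_biUnion_finset_le _ _).trans ?_
    refine (Finset.sum_le_sum fun e he => arcStep_tail hr (Finset.mem_compl.1 he) hs).trans ?_
    rw [Finset.sum_const, nsmul_eq_mul, hst, neg_add, Real.exp_add, Real.exp_neg (Real.log _),
      Real.exp_log (by positivity)]
    have hc : ((Sᶜ.card : ℕ) : ℝ) ≤ n := by
      have := Finset.card_le_univ Sᶜ
      rw [Fintype.card_fin] at this
      exact_mod_cast this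
    calc (Sᶜ.card : ℝ) * (2 * ((2 * (n : ℝ))⁻¹ * Real.exp (-t)))
        ≤ n * (2 * ((2 * (n : ℝ))⁻¹ * Real.exp (-t))) := by gcongr
      _ = Real.exp (-t) := by field_simp
  have hsub : {z | ¬ GoodNoise T S a s z} ⊆
      (({z | ∑ i, z i ^ 2 ≤ (n : ℝ) - √(8 * a * n)} ∪ {z | 9 * (n : ℝ) ≤ ∑ i, z i ^ 2})
        ∪ {z | (√(S.card : ℝ) + √(2 * a)) ^ 2 ≤ ∑ i ∈ S, (arcUnit T S i ⬝ᵥ z) ^ 2})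
        ∪ (⋃ e ∈ Sᶜ, {z | ¬ |arcStep T S e ⬝ᵥ z| ≤
          s * √(∑ i, z i ^ 2) * √(stepSq (arcSize T S (arcHead T S e)) (arcPos T S e))}) := by
    intro z hz
    by_contra hcon
    simp only [Set.mem_union, Set.mem_ofPred_eq, Set.mem_iUnion, not_or, not_exists, not_le,
      Finset.mem_compl] at hcon
    obtain ⟨⟨⟨c1, c2⟩, c3⟩, c4⟩ := hcon
    refine hz ⟨c1, c2, ?_, fun e he => not_lt.1 (c4 e he)⟩
    rw [← arcProjNorm_sq hr] at c3
    exact lt_of_pow_lt_pow_left₀ 2 (by positivity) c3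
  refine (measureReal_mono hsub).trans ?_
  refine (measureReal_union_le _ _).trans ?_
  have u1 := measureReal_union_le (μ := stdPi (Fin n))
    ({z | ∑ i, z i ^ 2 ≤ (n : ℝ) - √(8 * a * n)} ∪ {z | 9 * (n : ℝ) ≤ ∑ i, z i ^ 2})
    {z | (√(S.card : ℝ) + √(2 * a)) ^ 2 ≤ ∑ i ∈ S, (arcUnit T S i ⬝ᵥ z) ^ 2}
  have u2 := measureReal_union_le (μ := stdPi (Fin n))
    {z | ∑ i, z i ^ 2 ≤ (n : ℝ) - √(8 * a * n)} {z | 9 * (n : ℝ) ≤ ∑ i, z i ^ 2}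
  linarith

lemma hasLaw_inv_smul {Ω : Type*} [MeasurableSpace Ω] {P : Measure Ω} {ε : Ω → Fin n → ℝ} {σ : ℝ}
    (hσ : 0 < σ)
    (hε : HasLaw ε (Measure.pi fun _ : Fin n => gaussianReal 0 (σ ^ 2).toNNReal) P) :
    HasLaw (fun ω i => σ⁻¹ * ε ω i) (stdPi (Fin n)) P := by
  have h1 : MeasurePreserving (fun x : ℝ => σ⁻¹ * x) (gaussianReal 0 (σ ^ 2).toNNReal)
      (gaussianReal 0 1) := by
    refine ⟨by fun_prop, ?_⟩
    rw [gaussianReal_map_const_mul, mul_zero]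
    congr 1
    ext
    push_cast
    rw [Real.coe_toNNReal _ (sq_nonneg σ)]
    field_simp
  have h2 := measurePreserving_pi (fun _ : Fin n => gaussianReal 0 (σ ^ 2).toNNReal)
    (fun _ => gaussianReal 0 1) (fun _ => h1)
  refine ⟨h2.measurable.comp_aemeasurable hε.aemeasurable, ?_⟩
  have h3 := AEMeasurable.map_map_of_aemeasurable (μ := P) h2.measurable.aemeasurable
    hε.aemeasurable
  rw [hε.map_eq, h2.map_eq] at h3
  exact h3.symm

/-- As `B` is arbitrary, the bad noise event need not be shown measurable. -/
lemma measureReal_preimage_le_of_hasLaw {Ω X : Type*} [MeasurableSpace Ω] [MeasurableSpace X]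
    {P : Measure Ω} {μ : Measure X} [IsFiniteMeasure μ] {Z : Ω → X} (hZ : HasLaw Z μ P)
    (B : Set X) : P.real (Z ⁻¹' B) ≤ μ.real B := by
  have h := Measure.le_map_apply hZ.aemeasurable B
  rw [hZ.map_eq] at h
  exact ENNReal.toReal_mono (measure_ne_top _ _) h

end Noise


/-! ### Normalization and constants -/

section Bound

variable {n : ℕ} {S : Finset (Fin n)}

lemma nMin_le_card (hS : S.Nonempty) : nMin S ≤ n := by
  obtain ⟨s, _⟩ := hS
  refine (ciInf_le (OrderBot.bddBelow _) ((cycleMinus S).connectedComponentMk s)).trans ?_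
  refine (Set.ncard_le_ncard (Set.subset_univ _) (Set.toFinite _)).trans ?_
  rw [Set.ncard_univ, Nat.card_fin]

lemma normN_eq (v : Fin n → ℝ) : normN v = ‖(WithLp.toLp 2 v : EuclideanSpace ℝ (Fin n))‖ / √n := by
  rw [normN, norm_eq_sqrt_sum_sq, Real.sqrt_div (Finset.sum_nonneg fun _ _ => sq_nonneg _)]

lemma normN_sq (v : Fin n → ℝ) :
    normN v ^ 2 = ‖(WithLp.toLp 2 v : EuclideanSpace ℝ (Fin n))‖ ^ 2 / n := by
  rw [normN_eq, div_pow, Real.sq_sqrt (Nat.cast_nonneg n)]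

lemma normL1_cycleD (hn : 2 ≤ n) (g : Fin n → ℝ) :
    normL1 ((cycleD n).mulVec g) = totalVar (finRotate n) (WithLp.toLp 2 g) := by
  rw [normL1, totalVar]
  exact Finset.sum_congr rfl fun j _ => by rw [cycleD_mulVec hn]

lemma sqrt_mul_sqrtObjective (hn : 2 ≤ n) (lam : ℝ) (y g : Fin n → ℝ) :
    √n * sqrtObjective (cycleD n) lam y g
      = ‖(WithLp.toLp 2 y : EuclideanSpace ℝ (Fin n)) - WithLp.toLp 2 g‖
        + √n * lam * totalVar (finRotate n) (WithLp.toLp 2 g) := by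
  have hn0 : 0 < √(n : ℝ) := Real.sqrt_pos.2 (by exact_mod_cast (by omega : 0 < n))
  rw [sqrtObjective, normN_eq, normL1_cycleD hn, ← WithLp.toLp_sub]
  field_simp

lemma arcProjNorm_const_mul (T : Equiv.Perm (Fin n)) {σ : ℝ} (hσ : 0 ≤ σ) (z : Fin n → ℝ) :
    arcProjNorm T S (fun i => σ * z i) = σ * arcProjNorm T S z := by
  have h : ∀ i, arcMean T S (fun i => σ * z i) i = σ * arcMean T S z i := by
    intro i
    rw [arcMean, arcMean, ← Finset.mul_sum, mul_div_assoc]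
  simp only [arcProjNorm, h, mul_pow, ← Finset.mul_sum]
  rw [Real.sqrt_mul (sq_nonneg σ), Real.sqrt_sq hσ]

lemma noiseRatio_nonneg (n r : ℕ) (a : ℝ) : 0 ≤ noiseRatio n r a := by
  unfold noiseRatio; positivity

lemma signalConst_add_two_sq (n r : ℕ) (a η : ℝ) :
    (signalConst n r a η + 2) ^ 2 = (η / 2 - noiseRatio n r a) ^ 2 + 4 := by
  rw [signalConst, sub_add_cancel, Real.sq_sqrt (by positivity)]

lemma signalConst_nonneg (n r : ℕ) (a η : ℝ) : 0 ≤ signalConst n r a η := by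
  have : (2 : ℝ) ≤ √((η / 2 - noiseRatio n r a) ^ 2 + 4) :=
    Real.le_sqrt_of_sq_le (by nlinarith [sq_nonneg (η / 2 - noiseRatio n r a)])
  rw [signalConst]
  linarith

lemma signalConst_le {n r : ℕ} {a η : ℝ} (hη : η < 1) (h : 2 * noiseRatio n r a < η) :
    signalConst n r a η ≤ 1 / 3 := by
  have h0 := noiseRatio_nonneg n r a
  have h1 := signalConst_add_two_sq n r a η
  have h2 := signalConst_nonneg n r a η
  by_contra! h3
  nlinarith

lemma mul_mul_div_mul_self {u v : ℝ} (M x : ℝ) (hu : u ≠ 0) (hv : v ≠ 0) :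
    u * (M * (x / (u * v))) = M * (x / v) := by
  field_simp

lemma mul_mul_div_mul_mul {u v : ℝ} (b c d : ℝ) (hu : u ≠ 0) (hv : v ≠ 0) :
    u * b * (c / (u * v) * d) = b * (c * d) / v := by
  field_simp

/-- The error bound on the event of well-behaved noise. -/
theorem error_bound_of_goodNoise (hS : S.Nonempty) (hmin : 4 ≤ nMin S)
    {f0 e ghat : Fin n → ℝ} {σ a η lam s x : ℝ} (hσ : 0 < σ)
    (hassum : SqrtAssumption (cycleD n) S f0 σ a η lam) (hx : 0 ≤ x) (hs0 : 0 ≤ s)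
    (hs : s ^ 2 = 2 * x / ((n : ℝ) - 1))
    (hlam : 1 / (1 - η) * √((nMax S : ℝ) * (x / ((n : ℝ) * ((n : ℝ) - 1)))) ≤ lam)
    (hz : GoodNoise (finRotate n) S a s (fun i => σ⁻¹ * e i))
    (hg : IsSqrtAnalysisEstimator (cycleD n) lam (f0 + e) ghat) (f : Fin n → ℝ) :
    normN (ghat - f0) ^ 2 ≤ normN (f - f0) ^ 2
      + 16 * lam * σ * ∑ j ∈ Sᶜ, |(cycleD n).mulVec f j|
      + σ ^ 2 * (√(2 * a / n) + √((rDim (cycleD n) S : ℝ) / n)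
        + 4 * lam * √((n : ℝ) * kPrime S)
        + 4 * √10 / (1 - η) * √((rDim (cycleD n) S : ℝ) / ((n : ℝ) - 1) * x
          * Real.log ((n : ℝ) / (rDim (cycleD n) S : ℝ)))) ^ 2 := by
  have hn4 : 4 ≤ n := hmin.trans (nMin_le_card hS)
  have hn2 : 2 ≤ n := by omega
  have hr := exists_pow_finRotate_mem hn2 hS
  have hrD := rDim_cycleD hn2 hS
  have hsize : ∀ i ∈ S, 4 ≤ arcSize (finRotate n) S i :=
    fun i hi => hmin.trans (nMin_le_arcSize hn2 hS hi)
  obtain ⟨ha, han, hη0, hη1, ⟨R₀, hR₀, hR₀l⟩, hsig, -, hact⟩ := hassum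
  rw [hrD] at hsig hact ⊢
  have h1η : 0 < 1 - η := by linarith
  have hlam0 : 0 < lam := lt_of_lt_of_le (by positivity) hR₀l
  have hN : (4 : ℝ) ≤ n := by exact_mod_cast hn4
  have hN0 : (0 : ℝ) < n := by linarith
  have hN1 : (0 : ℝ) < (n : ℝ) - 1 := by linarith
  have hsn : 0 < √(n : ℝ) := Real.sqrt_pos.2 hN0
  have hsn2 := Real.sq_sqrt hN0.le
  set T := finRotate n with hT
  -- Multiplying the objective by `√n` passes from the normalized to the Euclidean norm.
  set Λ := √(n : ℝ) * lam with hΛ_def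
  have hΛ : 0 < Λ := by positivity
  set ρ := noiseRatio n S.card a with hρ
  have hρ0 : 0 ≤ ρ := noiseRatio_nonneg _ _ _
  set z : Fin n → ℝ := fun i => σ⁻¹ * e i with hz_def
  have hez : e = fun i => σ * z i := by
    ext i; simp only [hz_def]; field_simp
  set X : EuclideanSpace ℝ (Fin n) := WithLp.toLp 2 e with hX
  set F₀ : EuclideanSpace ℝ (Fin n) := WithLp.toLp 2 f0 with hF₀
  set G : EuclideanSpace ℝ (Fin n) := WithLp.toLp 2 ghat with hG
  set F : EuclideanSpace ℝ (Fin n) := WithLp.toLp 2 f with hF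
  have hXn : ‖X‖ = σ * √(∑ i, z i ^ 2) := by
    rw [norm_eq_sqrt_sum_sq, hX, hez]
    simp only [mul_pow, ← Finset.mul_sum]
    rw [Real.sqrt_mul (sq_nonneg σ), Real.sqrt_sq hσ.le]
  have hb0 : 0 < (n : ℝ) - √(8 * a * n) := by
    have : √(8 * a * n) < n := by
      rw [Real.sqrt_lt' hN0]; nlinarith
    linarith
  have hsb : 0 < √((n : ℝ) - √(8 * a * n)) := Real.sqrt_pos.2 hb0
  have hlow : σ * √((n : ℝ) - √(8 * a * n)) ≤ ‖X‖ := by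
    rw [hXn]
    exact mul_le_mul_of_nonneg_left (Real.sqrt_le_sqrt hz.lower.le) hσ.le
  have hX0 : 0 < ‖X‖ := lt_of_lt_of_le (by positivity) hlow
  have hup : ‖X‖ ≤ 3 * (σ * √n) := by
    rw [hXn, show 3 * (σ * √(n : ℝ)) = σ * (3 * √n) by ring]
    refine mul_le_mul_of_nonneg_left (Real.sqrt_le_iff.2 ⟨by positivity, ?_⟩) hσ.le
    rw [mul_pow, hsn2]
    linarith [hz.upper]
  have hproj0 : arcProjNorm T S X ≤ σ * (√(S.card : ℝ) + √(2 * a)) := by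
    have : arcProjNorm T S X = σ * arcProjNorm T S z := by
      rw [← arcProjNorm_const_mul T hσ.le, ← hez]
    rw [this]
    exact mul_le_mul_of_nonneg_left hz.proj.le hσ.le
  have hproj : arcProjNorm T S X ≤ ρ * ‖X‖ := by
    refine hproj0.trans ?_
    have : σ * (√(S.card : ℝ) + √(2 * a)) = ρ * (σ * √((n : ℝ) - √(8 * a * n))) := by
      rw [hρ, noiseRatio, mul_comm σ (√((n : ℝ) - √(8 * a * n))), ← mul_assoc,
        div_mul_cancel₀ _ hsb.ne', mul_comm]
    rw [this]
    exact mul_le_mul_of_nonneg_left hlow hρ0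
  have hnoise : ∀ i ∉ S, |arcStep T S i ⬝ᵥ X| ≤
      s * ‖X‖ * √(stepSq (arcSize T S (arcHead T S i)) (arcPos T S i)) := by
    intro i hi
    have h1 : arcStep T S i ⬝ᵥ X = σ * (arcStep T S i ⬝ᵥ z) := by
      rw [← smul_eq_mul, ← dotProduct_smul]
      congr 1
    rw [h1, abs_mul, abs_of_pos hσ, hXn]
    have := mul_le_mul_of_nonneg_left (hz.noise i hi) hσ.le
    linarith
  have hΛF : Λ * totalVar T F₀ ≤ signalConst n S.card a η * ‖X‖ := by
    rw [normL1_cycleD hn2, le_div_iff₀ hlam0] at hsig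
    have h1 : √(n : ℝ) * √(1 - √(8 * a / n)) = √((n : ℝ) - √(8 * a * n)) := by
      rw [← Real.sqrt_mul hN0.le, mul_sub, mul_one]
      congr 2
      rw [show 8 * a * n = (n : ℝ) ^ 2 * (8 * a / n) by field_simp,
        Real.sqrt_mul (sq_nonneg _), Real.sqrt_sq hN0.le]
    have h2 := mul_le_mul_of_nonneg_left hsig hsn.le
    have h3 := mul_le_mul_of_nonneg_left hlow (signalConst_nonneg n S.card a η)
    calc Λ * totalVar T F₀ = √n * (totalVar T F₀ * lam) := by rw [hΛ_def]; ring
      _ ≤ _ := h2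
      _ = signalConst n S.card a η * (σ * (√n * √(1 - √(8 * a / n)))) := by ring
      _ ≤ _ := by rw [h1]; exact h3
  have hΛF0 : 0 ≤ Λ * totalVar T F₀ := mul_nonneg hΛ.le (totalVar_nonneg _ _)
  have hsignal : (Λ * totalVar T F₀ + 2 * ‖X‖) ^ 2 ≤ ((η / 2 - ρ) ^ 2 + 4) * ‖X‖ ^ 2 := by
    rw [← signalConst_add_two_sq, ← mul_pow]
    exact pow_le_pow_left₀ (by positivity) (by linarith) 2
  have hopt : ∀ g, ‖F₀ + X - G‖ + Λ * totalVar T G ≤ ‖F₀ + X - g‖ + Λ * totalVar T g := by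
    intro g
    have h1 := mul_le_mul_of_nonneg_left (hg g.ofLp) hsn.le
    rw [sqrt_mul_sqrtObjective hn2, sqrt_mul_sqrtObjective hn2, WithLp.toLp_add] at h1
    exact h1
  have hdom : ∀ i ∈ S, s * √(arcSize T S i : ℝ) ≤ 2 * (Λ * (1 - η)) := by
    intro i hi
    have h1 : √((nMax S : ℝ) * (x / ((n : ℝ) * ((n : ℝ) - 1)))) ≤ lam * (1 - η) := by
      rw [one_div_mul_eq_div, div_le_iff₀ h1η] at hlam
      exact hlam
    have h2 : (arcSize T S i : ℝ) ≤ nMax S := by exact_mod_cast arcSize_le_nMax hn2 hS hi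
    have h3 : s * √(arcSize T S i : ℝ)
        ≤ 2 * (√n * √((nMax S : ℝ) * (x / ((n : ℝ) * ((n : ℝ) - 1))))) := by
      rw [← Real.sqrt_mul hN0.le]
      refine (pow_le_pow_iff_left₀ (by positivity) (by positivity) two_ne_zero).1 ?_
      rw [mul_pow, mul_pow, hs, Real.sq_sqrt (Nat.cast_nonneg _), Real.sq_sqrt (by positivity),
        mul_mul_div_mul_self _ _ hN0.ne' hN1.ne']
      have h5 := mul_le_mul_of_nonneg_left h2 (show 0 ≤ 2 * x / ((n : ℝ) - 1) by positivity)
      have h6 : 0 ≤ 2 * x / ((n : ℝ) - 1) * nMax S := by positivity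
      refine h5.trans ?_
      have h7 : (2 : ℝ) ^ 2 * ((nMax S : ℝ) * (x / ((n : ℝ) - 1)))
          = 2 * (2 * x / ((n : ℝ) - 1) * nMax S) := by ring
      linarith
    have h4 := mul_le_mul_of_nonneg_left h1 hsn.le
    rw [hΛ_def]
    linarith
  have hmain := oracle_inequality_of_noise hr (fun i hi => by have := hsize i hi; omega) hΛ hs0
    hη0 hη1 hρ0 hact hdom hX0 hopt hnoise hproj hsignal F
  rw [← kPrime_eq_sum hn2 hS] at hmain
  set K := kPrime S with hK
  set Rr := ‖F₀ + X - G‖ with hRr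
  -- The residual is at most `(1 + 1/3) ‖X‖`, and `‖X‖ ≤ 3σ√n`.
  have hR4 : Rr ≤ 4 * (σ * √n) := by
    have h1 := norm_residual_le hΛ hopt
    have h2 := mul_le_mul_of_nonneg_right (signalConst_le hη1 hact) hX0.le
    linarith
  have hΛR : Λ * Rr ≤ 4 * (lam * σ * n) := by
    have := mul_le_mul_of_nonneg_left hR4 hΛ.le
    refine this.trans (le_of_eq ?_)
    rw [hΛ_def]
    linear_combination 4 * lam * σ * hsn2
  have hrc : (0 : ℝ) < S.card := by exact_mod_cast hS.card_pos
  set L := (S.card : ℝ) / ((n : ℝ) - 1) * x * Real.log ((n : ℝ) / (S.card : ℝ)) with hL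
  -- The 10 is the 5 of the profile bound times the 2 in `s² = 2x/(n - 1)`.
  have hlog : s * √(∑ i ∈ S, 5 * Real.log (arcSize T S i)) ≤ √10 * √L := by
    have h1 := sum_log_arcSize_le hr hS (fun i hi => by have := hsize i hi; omega)
    rw [Fintype.card_fin] at h1
    rw [← Real.sqrt_sq hs0, hs, ← Real.sqrt_mul (by positivity), ← Real.sqrt_mul (by norm_num),
      ← Finset.mul_sum]
    refine Real.sqrt_le_sqrt ?_
    have h2 := mul_le_mul_of_nonneg_left h1 (show 0 ≤ 10 * x / ((n : ℝ) - 1) by positivity)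
    refine le_trans (le_of_eq ?_) (h2.trans (le_of_eq ?_))
    · ring
    · rw [hL]; ring
  have hB : arcProjNorm T S X + Λ * Rr * (√K + s / (Λ * (1 - η)) *
        √(∑ i ∈ S, 5 * Real.log (arcSize T S i)))
      ≤ √n * (σ * (√(2 * a / n) + √((S.card : ℝ) / n) + 4 * lam * √((n : ℝ) * K)
        + 4 * √10 / (1 - η) * √L)) := by
    have e1 : √(n : ℝ) * √(2 * a / n) = √(2 * a) := by
      rw [← Real.sqrt_mul hN0.le, mul_div_cancel₀ _ hN0.ne']
    have e2 : √(n : ℝ) * √((S.card : ℝ) / n) = √(S.card : ℝ) := by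
      rw [← Real.sqrt_mul hN0.le, mul_div_cancel₀ _ hN0.ne']
    have e3 : √(n : ℝ) * √((n : ℝ) * K) = n * √K := by
      rw [Real.sqrt_mul hN0.le, ← mul_assoc, ← sq, hsn2]
    have t1 : Λ * Rr * √K ≤ 4 * (lam * σ * n) * √K :=
      mul_le_mul_of_nonneg_right hΛR (Real.sqrt_nonneg _)
    have t2 : Λ * Rr * (s / (Λ * (1 - η)) * √(∑ i ∈ S, 5 * Real.log (arcSize T S i)))
        ≤ 4 * (σ * √n) * (√10 * √L) / (1 - η) := by
      have : Λ * Rr * (s / (Λ * (1 - η)) * √(∑ i ∈ S, 5 * Real.log (arcSize T S i)))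
          = Rr * (s * √(∑ i ∈ S, 5 * Real.log (arcSize T S i))) / (1 - η) :=
        mul_mul_div_mul_mul _ _ _ hΛ.ne' h1η.ne'
      rw [this]
      refine div_le_div_of_nonneg_right ?_ h1η.le
      exact mul_le_mul hR4 hlog (by positivity) (by positivity)
    have e4 : √n * (σ * (√(2 * a / n) + √((S.card : ℝ) / n) + 4 * lam * √((n : ℝ) * K)
        + 4 * √10 / (1 - η) * √L))
        = σ * (√(S.card : ℝ) + √(2 * a)) + 4 * (lam * σ * n) * √K
          + 4 * (σ * √n) * (√10 * √L) / (1 - η) := by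
      linear_combination σ * e1 + σ * e2 + 4 * lam * σ * e3
    rw [e4]
    linarith
  have hB0 : 0 ≤ arcProjNorm T S X + Λ * Rr * (√K + s / (Λ * (1 - η)) *
        √(∑ i ∈ S, 5 * Real.log (arcSize T S i))) := by
    have : 0 ≤ arcProjNorm T S X := Real.sqrt_nonneg _
    have : 0 ≤ Rr := norm_nonneg _
    positivity
  have hB2 := pow_le_pow_left₀ hB0 hB 2
  rw [mul_pow, hsn2, mul_pow] at hB2
  have hD : ∑ j ∈ Sᶜ, |(cycleD n).mulVec f j| = ∑ j ∈ Sᶜ, |F (T j) - F j| :=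
    Finset.sum_congr rfl fun j _ => by rw [cycleD_mulVec hn2]
  have hD0 : 0 ≤ ∑ j ∈ Sᶜ, |F (T j) - F j| := Finset.sum_nonneg fun _ _ => abs_nonneg _
  have hW := mul_le_mul_of_nonneg_right hΛR hD0
  rw [normN_sq, normN_sq, WithLp.toLp_sub, WithLp.toLp_sub, hD,
    div_le_iff₀ hN0, add_mul, add_mul, div_mul_cancel₀ _ hN0.ne']
  linarith

end Bound

end SqrtTV

/-! ### The bound in probability -/

theorem corollary4p7
    {Ω : Type*} [MeasurableSpace Ω] (P : Measure Ω) [IsProbabilityMeasure P]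
    (n : ℕ) (f0 : Fin n → ℝ) (σ : ℝ) (hσ : 0 < σ)
    (ε : Ω → Fin n → ℝ)
    (hε : HasLaw ε (Measure.pi fun _ : Fin n => gaussianReal 0 (σ ^ 2).toNNReal) P)
    (S : Finset (Fin n)) (hS : S.Nonempty) (hmin : 4 ≤ SqrtTV.nMin S)
    (a η t lam : ℝ)
    (hassum : SqrtTV.SqrtAssumption (SqrtTV.cycleD n) S f0 σ a η lam)
    (ht0 : 0 < t)
    (ht1 : t < ((n : ℝ) - 1) / 2 -
      Real.log (2 * ((n : ℝ) - (SqrtTV.rDim (SqrtTV.cycleD n) S : ℝ))))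
    (hlam : 1 / (1 - η) *
      √((SqrtTV.nMax S : ℝ) * ((Real.log (2 * n) + t) / ((n : ℝ) * ((n : ℝ) - 1)))) ≤ lam)
    (fhat : Ω → Fin n → ℝ) (hmeas : AEMeasurable fhat P)
    (hfhat : ∀ᵐ ω ∂P,
      SqrtTV.IsSqrtAnalysisEstimator (SqrtTV.cycleD n) lam (f0 + ε ω) (fhat ω))
    (f : Fin n → ℝ) :
    1 - Real.exp (-t) - 4 * Real.exp (-a) ≤
      P.real {ω | SqrtTV.normN (fhat ω - f0) ^ 2 ≤
        SqrtTV.normN (f - f0) ^ 2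
          + 16 * lam * σ * ∑ j ∈ Sᶜ, |(SqrtTV.cycleD n).mulVec f j|
          + σ ^ 2 *
            (√(2 * a / n) + √((SqrtTV.rDim (SqrtTV.cycleD n) S : ℝ) / n)
              + 4 * lam * √((n : ℝ) * SqrtTV.kPrime S)
              + 4 * √10 / (1 - η) *
                √((SqrtTV.rDim (SqrtTV.cycleD n) S : ℝ) / ((n : ℝ) - 1)
                  * (Real.log (2 * n) + t)
                  * Real.log ((n : ℝ) / (SqrtTV.rDim (SqrtTV.cycleD n) S : ℝ)))) ^ 2} := by
  open SqrtTV in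
  have hn4 : 4 ≤ n := hmin.trans (nMin_le_card hS)
  have hN : (4 : ℝ) ≤ n := by exact_mod_cast hn4
  have hN1 : (0 : ℝ) < (n : ℝ) - 1 := by linarith
  have hr := exists_pow_finRotate_mem (show 2 ≤ n by omega) hS
  have hx : 0 ≤ Real.log (2 * n) + t := by
    have := Real.log_nonneg (show (1 : ℝ) ≤ 2 * n by linarith)
    linarith
  set s := √(2 * (Real.log (2 * n) + t) / ((n : ℝ) - 1)) with hs_def
  have hs0 : 0 ≤ s := Real.sqrt_nonneg _
  have hs : s ^ 2 = 2 * (Real.log (2 * n) + t) / ((n : ℝ) - 1) := Real.sq_sqrt (by positivity)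
  have ha := hassum.a_pos
  have han := hassum.a_lt
  have hsize : ∀ i ∈ S, 0 < arcSize (finRotate n) S i := fun i hi => by
    have := nMin_le_arcSize (show 2 ≤ n by omega) hS hi
    omega
  have hbad := goodNoise_compl_le hr hS hsize (a := a) (s := s) (t := t) ha (by linarith) hs0
    (by rw [hs]; field_simp)
  have hbadP := (measureReal_preimage_le_of_hasLaw (hasLaw_inv_smul hσ hε) _).trans hbad
  set good : Set Ω := {ω | normN (fhat ω - f0) ^ 2 ≤ _} with hgood
  set bad : Set Ω :=
    (fun ω i => σ⁻¹ * ε ω i) ⁻¹' {z | ¬ GoodNoise (finRotate n) S a s z} with hbad_def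
  set nul : Set Ω := {ω | ¬ IsSqrtAnalysisEstimator (cycleD n) lam (f0 + ε ω) (fhat ω)} with hnul
  have hnul0 : P.real nul = 0 := by
    rw [measureReal_def, show P nul = 0 from hfhat, ENNReal.toReal_zero]
  -- Covering the whole space and using subadditivity, rather than taking complements, avoids
  -- measurability of the three sets. The noise bound loses only `3 exp (-a)`, within the allowed 4.
  have hcover : (Set.univ : Set Ω) ⊆ good ∪ (bad ∪ nul) := by
    intro ω _
    by_contra hcon
    simp only [Set.mem_union, not_or] at hcon
    obtain ⟨h1, h2, h3⟩ := hcon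
    have hz : GoodNoise (finRotate n) S a s (fun i => σ⁻¹ * ε ω i) := not_not.1 h2
    have hg : IsSqrtAnalysisEstimator (cycleD n) lam (f0 + ε ω) (fhat ω) := not_not.1 h3
    exact h1 (error_bound_of_goodNoise hS hmin hσ hassum hx hs0 hs hlam hz hg f)
  have h1 : (1 : ℝ) ≤ P.real good + (P.real bad + P.real nul) := by
    have := measureReal_mono (μ := P) hcover
    rw [probReal_univ] at this
    exact this.trans ((measureReal_union_le _ _).trans
      (add_le_add_right (measureReal_union_le _ _) _))
  have := Real.exp_pos (-a)
  linarith
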